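/- Let $A\in SL(3,\mathbb Z)$ have a non-real eigenvalue $\alpha$ (hence also $\overline\alpha$) and a real eigenvalue $c>1$, and let $(\alpha_1,\alpha_2,\alpha_3)\in\mathbb C^3$ and $(c_1,c_2,c_3)\in\mathbb R^3$ be eigenvectors of $A$ for $\alpha$ and $c$. Let $\mathbf H$ be the upper half-plane, let $\Gamma$ be the group of automorphisms of $\mathbb C\times\mathbf H$ generated by $g_0(z,w)=(\alpha z,cw)$ and $g_i(z,w)=(z+\alpha_i,w+c_i)$, $i=1,2,3$, and let $S=(\mathbb C\times\mathbf H)/\Gamma$ be the corresponding Inoue surface of type $S^0$. A para-hyperhermitian structure on the complex surface $S$ is a quadruple $(g,I,S_1,T)$, where $g$ is a smooth pseudo-Riemannian metric on $S$, $I$ is the complex structure of $S$, and $S_1,T$ are smooth endomorphisms of the tangent bundle with $S_1^2=T^2=\mathrm{Id}$, $T=IS_1=-S_1I$, such that $I,S_1,T$ are integrable (the Nijenhuis tensors $N_B(X,Y)=[BX,BY]+B^2[X,Y]-B[BX,Y]-B[X,BY]$, $B=I,S_1,T$, vanish) and skew-symmetric with respect to $g$. Its $(2,0)$-form is $\Omega=\Omega_2+i\Omega_3$,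 where $\Omega_2(X,Y)=g(S_1X,Y)$ and $\Omega_3(X,Y)=g(TX,Y)$. Suppose that $S$ is presented in any way as a quotient of a simply connected solvable real Lie group $G$ by a discrete subgroup acting by left translations; equivalently, there is a diffeomorphism $\Phi:\mathbb C\times\mathbf H\to G$ that turns every element of $\Gamma$ into a left translation of $G$. Then $S$ admits no para-hyperhermitian structure whose $(2,0)$-form is defined by a left-invariant complex-valued $2$-form on $G$, that is, whose $(2,0)$-form lifted to $\mathbb C\times\mathbf H$ is $\Phi^*\eta$ for a left-invariant complex-valued $2$-form $\eta$ on $G$. -/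

import Mathlib

open scoped ContDiff Manifold Matrix

/-! ### Para-hyperhermitian structures on an open set of a real vector space -/

section ParaHyperhermitianStructures

variable {V : Type*} [NormedAddCommGroup V] [NormedSpace ℝ V]

/-- The Nijenhuis tensor `N_A(X,Y) = [AX,AY] + A²[X,Y] - A[AX,Y] - A[X,AY]` of a field `A` of
endomorphisms, evaluated on two vector fields at the point `p`. -/
noncomputable def nijenhuis (A : V → V →L[ℝ] V) (X Y : V → V) (p : V) : V :=
  VectorField.lieBracket ℝ (fun q => A q (X q)) (fun q => A q (Y q)) p
    + A p (A p (VectorField.lieBracket ℝ X Y p))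
    - A p (VectorField.lieBracket ℝ (fun q => A q (X q)) Y p)
    - A p (VectorField.lieBracket ℝ X (fun q => A q (Y q)) p)

/-- Integrability of a field of endomorphisms on `U`: its Nijenhuis tensor vanishes on `U`. -/
def IsIntegrableOn (A : V → V →L[ℝ] V) (U : Set V) : Prop :=
  ∀ X Y : V → V, ContDiffOn ℝ ∞ X U → ContDiffOn ℝ ∞ Y U →
    ∀ p ∈ U, nijenhuis A X Y p = 0

/-- A para-hyperhermitian structure `(g, I, S, T)` on the open set `U`: a smooth
pseudo-Riemannian metric `g` and smooth integrable fields of endomorphisms `I`, `S`, `T` with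
`I² = -1`, `S² = T² = 1`, `T = IS = -SI`, for which `I`, `S`, `T` are `g`-skew-symmetric.
Only the values on `U` matter. -/
structure ParaHyperhermitian (U : Set V) where
  g : V → V →L[ℝ] V →L[ℝ] ℝ
  I : V → V →L[ℝ] V
  S : V → V →L[ℝ] V
  T : V → V →L[ℝ] V
  smooth_g : ContDiffOn ℝ ∞ g U
  smooth_I : ContDiffOn ℝ ∞ I U
  smooth_S : ContDiffOn ℝ ∞ S U
  smooth_T : ContDiffOn ℝ ∞ T U
  g_symm : ∀ p ∈ U, ∀ u v, g p u v = g p v u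
  g_nondegenerate : ∀ p ∈ U, ∀ u, (∀ v, g p u v = 0) → u = 0
  I_sq : ∀ p ∈ U, ∀ u, I p (I p u) = -u
  S_sq : ∀ p ∈ U, ∀ u, S p (S p u) = u
  T_sq : ∀ p ∈ U, ∀ u, T p (T p u) = u
  T_eq : ∀ p ∈ U, ∀ u, T p u = I p (S p u)
  I_S_anticomm : ∀ p ∈ U, ∀ u, I p (S p u) = -S p (I p u)
  I_skew : ∀ p ∈ U, ∀ u v, g p (I p u) v = -g p u (I p v)
  S_skew : ∀ p ∈ U, ∀ u v, g p (S p u) v = -g p u (S p v)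
  T_skew : ∀ p ∈ U, ∀ u v, g p (T p u) v = -g p u (T p v)
  I_integrable : IsIntegrableOn I U
  S_integrable : IsIntegrableOn S U
  T_integrable : IsIntegrableOn T U

/-- The `(2,0)`-form `Ω = Ω₂ + iΩ₃`, where `Ω₂(u,v) = g(Su,v)` and `Ω₃(u,v) = g(Tu,v)`. -/
noncomputable def ParaHyperhermitian.form20 {U : Set V} (P : ParaHyperhermitian U)
    (p u v : V) : ℂ :=
  (P.g p (P.S p u) v : ℂ) + Complex.I * (P.g p (P.T p u) v : ℂ)

/-- The structure is preserved by the transformation `φ` (a local diffeomorphism mapping `U`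
to itself): `φ` is an isometry and its differential commutes with `I`, `S`, `T`. -/
structure ParaHyperhermitian.IsPreservedBy {U : Set V} (P : ParaHyperhermitian U)
    (φ : V → V) : Prop where
  g_eq : ∀ p ∈ U, ∀ u v, P.g (φ p) (fderiv ℝ φ p u) (fderiv ℝ φ p v) = P.g p u v
  I_eq : ∀ p ∈ U, ∀ u, P.I (φ p) (fderiv ℝ φ p u) = fderiv ℝ φ p (P.I p u)
  S_eq : ∀ p ∈ U, ∀ u, P.S (φ p) (fderiv ℝ φ p u) = fderiv ℝ φ p (P.S p u)
  T_eq : ∀ p ∈ U, ∀ u, P.T (φ p) (fderiv ℝ φ p u) = fderiv ℝ φ p (P.T p u)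

end ParaHyperhermitianStructures

/-! ### Inoue surfaces of type `S⁰` -/

/-- The complex domain `ℂ × H`, where `H` is the upper half-plane. -/
def CxH : Set (ℂ × ℂ) := {p | 0 < p.2.im}

/-- The data defining an Inoue surface of type `S⁰`: a matrix `A ∈ SL(3,ℤ)` with a non-real
eigenvalue `α` (hence also the eigenvalue `conj α`) and a real eigenvalue `c > 1`, and
eigenvectors `(α₁,α₂,α₃) ∈ ℂ³` and `(c₁,c₂,c₃) ∈ ℝ³` for `α` and `c`. -/
structure InoueDatum where
  A : Matrix.SpecialLinearGroup (Fin 3) ℤ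
  α : ℂ
  c : ℝ
  αvec : Fin 3 → ℂ
  cvec : Fin 3 → ℝ
  α_im_ne_zero : α.im ≠ 0
  one_lt_c : 1 < c
  αvec_ne_zero : αvec ≠ 0
  cvec_ne_zero : cvec ≠ 0
  αvec_eigen : (A : Matrix (Fin 3) (Fin 3) ℤ).map (Int.cast : ℤ → ℂ) *ᵥ αvec = α • αvec
  cvec_eigen : (A : Matrix (Fin 3) (Fin 3) ℤ).map (Int.cast : ℤ → ℝ) *ᵥ cvec = c • cvec

namespace InoueDatum

variable (X : InoueDatum)

theorem α_ne_zero : X.α ≠ 0 := fun h => X.α_im_ne_zero (by simp [h])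

theorem c_ne_zero : (X.c : ℂ) ≠ 0 :=
  Complex.ofReal_ne_zero.mpr (zero_lt_one.trans X.one_lt_c).ne'

/-- `g₀ : (z,w) ↦ (α z, c w)`. -/
noncomputable def gen0 : Equiv.Perm (ℂ × ℂ) :=
  Equiv.prodCongr (Equiv.mulLeft₀ X.α X.α_ne_zero) (Equiv.mulLeft₀ (X.c : ℂ) X.c_ne_zero)

/-- `gᵢ : (z,w) ↦ (z + αᵢ, w + cᵢ)` for `i = 1, 2, 3`. -/
noncomputable def gen (i : Fin 3) : Equiv.Perm (ℂ × ℂ) :=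
  Equiv.addRight (X.αvec i, (X.cvec i : ℂ))

/-- The group `Γ` generated by `g₀, g₁, g₂, g₃`. Its elements map `ℂ × H` onto itself, and the
Inoue surface of type `S⁰` is the quotient `S = (ℂ × H) / Γ`. -/
noncomputable def Γ : Subgroup (Equiv.Perm (ℂ × ℂ)) :=
  Subgroup.closure (insert X.gen0 (Set.range X.gen))

/-- A para-hyperhermitian structure on the complex surface `S = (ℂ × H) / Γ`. Since
`ℂ × H → S` is the universal covering with deck group `Γ`, tensor fields on `S` are given by
the `Γ`-invariant tensor fields on `ℂ × H`. The endomorphism `I` is the complex structure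
of `S`, which lifts to multiplication by `i`. -/
structure ParaHyperhermitianStructure extends ParaHyperhermitian CxH where
  invariant : ∀ γ ∈ X.Γ, toParaHyperhermitian.IsPreservedBy γ
  I_eq_complex_structure : ∀ p ∈ CxH, ∀ u : ℂ × ℂ, I p u = Complex.I • u

/-- A presentation of `S = (ℂ × H) / Γ` as a quotient of a simply connected Lie group `G` by a
discrete subgroup acting by left translations, lifted to the universal coverings: a
diffeomorphism `Φ` from `ℂ × H` onto `G`, with inverse `Ψ`, that turns every element of `Γ`
into a left translation of `G`. -/
structure QuotientPresentation (E : Type*) [NormedAddCommGroup E] [NormedSpace ℝ E]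
    (G : Type*) [TopologicalSpace G] [ChartedSpace E G] [Group G] where
  Φ : ℂ × ℂ → G
  Ψ : G → ℂ × ℂ
  smooth_Φ : ContMDiffOn 𝓘(ℝ, ℂ × ℂ) 𝓘(ℝ, E) ∞ Φ CxH
  smooth_Ψ : ContMDiff 𝓘(ℝ, E) 𝓘(ℝ, ℂ × ℂ) ∞ Ψ
  Ψ_mem : ∀ x, Ψ x ∈ CxH
  Φ_Ψ : ∀ x, Φ (Ψ x) = x
  Ψ_Φ : ∀ p ∈ CxH, Ψ (Φ p) = p
  equivariant : ∀ γ ∈ X.Γ, ∃ a : G, ∀ p ∈ CxH, Φ (γ p) = a * Φ p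

end InoueDatum

/-! ### Left-invariant forms -/

section LeftInvariant

variable {E : Type*} [NormedAddCommGroup E] [NormedSpace ℝ E]
  {G : Type*} [TopologicalSpace G] [ChartedSpace E G] [Group G]

/-- A complex-valued `2`-form `η` on `G` is left-invariant. -/
def IsLeftInvariantTwoForm (η : (x : G) → TangentSpace 𝓘(ℝ, E) x [⋀^Fin 2]→L[ℝ] ℂ) : Prop :=
  ∀ (a x : G) (u v : TangentSpace 𝓘(ℝ, E) x),
    η (a * x) ![mfderiv 𝓘(ℝ, E) 𝓘(ℝ, E) (fun y => a * y) x u,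
      mfderiv 𝓘(ℝ, E) 𝓘(ℝ, E) (fun y => a * y) x v] = η x ![u, v]

/-- The `(2,0)`-form `Ω₂ + iΩ₃` of a para-hyperhermitian structure on `S` is defined by the
`2`-form `η` on `G`: the two forms have the same lift to the universal covering `ℂ × H`. -/
def InoueDatum.ParaHyperhermitianStructure.Form20DefinedBy {X : InoueDatum}
    (P : X.ParaHyperhermitianStructure) (Q : X.QuotientPresentation E G)
    (η : (x : G) → TangentSpace 𝓘(ℝ, E) x [⋀^Fin 2]→L[ℝ] ℂ) : Prop :=
  ∀ p ∈ CxH, ∀ u v : ℂ × ℂ,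
    P.form20 p u v =
      η (Q.Φ p) ![mfderiv 𝓘(ℝ, ℂ × ℂ) 𝓘(ℝ, E) Q.Φ p u, mfderiv 𝓘(ℝ, ℂ × ℂ) 𝓘(ℝ, E) Q.Φ p v]

end LeftInvariant

/-!
Write `Ω = φ dz ∧ dw` on `ℂ × H`. The left translations of `G`, transported to `ℂ × H`, form a
simply transitive family of maps preserving `Ω`. The proof shows first that `φ` is a function of `y
= Im w` with special properties (`HomogeneousForm`), and then that no metric and product structure
can be integrable with such a `φ`.

*The coefficient.* A map preserving `Ω` is holomorphic, and two applications of Liouville's theorem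
show that it has the form `(z, w) ↦ (f(w) z + h(w), m(w))`: entire functions into `H` are constant,
and `φ` is bounded above and below on the sets `Im w = const`, which cover the compact torus fibres
of `S → S¹`. If `m(w) = w` then `f(w) = 1`, for otherwise the map would have a fixed point; so on
each fibre `ℂ × {w}` the translations multiply `φ` by constants, and `d log φ` has constant
coefficients there. As this form is closed, periodic under the lattice of translations in `Γ` and
compatible with `g₀`, its vertical part vanishes. Hence `φ` does not depend on `z`, and by density
of `ℤc₁ + ℤc₂ + ℤc₃` in `ℝ` it depends only on `y` (`HomogeneousForm.eq_of_im`). Applying `∂/∂w̄`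
to `φ(ψ) · f m' = φ`, with `ℓ = φ'/φ`, gives `ℓ(Im m) conj m' = ℓ(y)`, and then `ℓ'(Im m) |m'|² =
ℓ'(y)`. So `Im ℓ'` vanishes nowhere or everywhere, and in the second case `φ(cy) α c = φ(y)` would
force `α` to be real (`HomogeneousForm.im_deriv_logDer_ne_zero`).

*The integrability equations.* Let `a = g(e₁,e₁)`, `d = g(e₂,e₂)` and `b = g(e₁,e₂) + i g(ie₁,e₂)`,
so that `|b|² - ad = |φ|²`. With `∂̄` denoting twice the usual operator, the vanishing of the
Nijenhuis tensor of `S` yields `∂̄₁ d = ∂̄₂ b - iℓ b` and `∂̄₁ b̄ = ∂̄₂ a - iℓ a`. Their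
compatibility condition is `Im ℓ' · a = 0` (`HomogeneousForm.eq_zero_of_integrability`), so `a =
0`. Then `b̄` is holomorphic and bounded in `z`, so `b` depends only on `y`; the derivative `∂̄₁ d`
is constant on the fibres while `d` is bounded there, so it vanishes, and `b` is a constant
multiple of `φ`. Under `g₀` the functions `b` and `φ` are multiplied by factors involving `conj α`
and `α` respectively, so `b = 0`, a contradiction.
-/

/-! ### The lattice of translations of an Inoue surface -/

namespace InoueDatum

variable (X : InoueDatum)

theorem conj_α_ne : (starRingEnd ℂ) X.α ≠ X.α := fun h =>
  X.α_im_ne_zero (Complex.conj_eq_iff_im.mp h)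

theorem α_ne_one : X.α ≠ 1 := fun h => X.α_im_ne_zero (by simp [h])

/-- The three eigenvectors of `A`, for the distinct eigenvalues `α`, `conj α` and `c`, form a
basis of `ℂ³`, so a real vector orthogonal to all of them vanishes. -/
theorem eq_zero_of_sum_eq_zero (r : Fin 3 → ℝ) (h₁ : ∑ i, (r i : ℂ) * X.αvec i = 0)
    (h₂ : ∑ i, r i * X.cvec i = 0) : r = 0 := by
  set M : Matrix (Fin 3) (Fin 3) ℂ := (X.A : Matrix (Fin 3) (Fin 3) ℤ).map (Int.cast : ℤ → ℂ)
    with hM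
  let μ : Fin 3 → ℂ := ![X.α, (starRingEnd ℂ) X.α, (X.c : ℂ)]
  let w : Fin 3 → Fin 3 → ℂ :=
    ![X.αvec, fun i => (starRingEnd ℂ) (X.αvec i), fun i => (X.cvec i : ℂ)]
  have hμ : Function.Injective μ := by
    have h01 : X.α ≠ (starRingEnd ℂ) X.α := X.conj_α_ne.symm
    have h02 : X.α ≠ (X.c : ℂ) := fun h => X.α_im_ne_zero (by simp [h])
    have h12 : (starRingEnd ℂ) X.α ≠ (X.c : ℂ) := fun h => X.α_im_ne_zero (by
      simpa using congrArg Complex.im h)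
    intro i j hij
    fin_cases i <;> fin_cases j <;> simp_all [μ]
  have hw : ∀ i, Module.End.HasEigenvector (Matrix.toLin' M) (μ i) (w i) := by
    have e0 := X.αvec_eigen
    have e2 := X.cvec_eigen
    intro i
    rw [Module.End.hasEigenvector_iff, Module.End.mem_eigenspace_iff, Matrix.toLin'_apply]
    fin_cases i
    · exact ⟨e0, X.αvec_ne_zero⟩
    · refine ⟨?_, fun h => X.αvec_ne_zero ?_⟩
      · funext j
        have := congrArg (starRingEnd ℂ) (congrFun e0 j)
        simpa [Matrix.mulVec, dotProduct, w, μ, M] using this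
      · funext j
        simpa [w] using congrFun h j
    · refine ⟨?_, fun h => X.cvec_ne_zero ?_⟩
      · funext j
        have := congrArg (fun t : ℝ => (t : ℂ)) (congrFun e2 j)
        simpa [Matrix.mulVec, dotProduct, w, μ, M] using this
      · funext j
        simpa [w] using congrFun h j
  have hli : LinearIndependent ℂ (Matrix.of w).row :=
    Module.End.eigenvectors_linearIndependent' _ μ hμ w hw
  rw [Matrix.linearIndependent_rows_iff_isUnit, Matrix.isUnit_iff_isUnit_det,
    isUnit_iff_ne_zero] at hli
  have h0 : Matrix.of w *ᵥ (fun i => (r i : ℂ)) = 0 := by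
    funext j
    fin_cases j
    · simpa [Matrix.mulVec, dotProduct, w, mul_comm] using h₁
    · have := congrArg (starRingEnd ℂ) h₁
      simpa [Matrix.mulVec, dotProduct, w, mul_comm] using this
    · have := congrArg (fun t : ℝ => (t : ℂ)) h₂
      simpa [Matrix.mulVec, dotProduct, w, mul_comm] using this
  have := Matrix.eq_zero_of_mulVec_eq_zero hli h0
  funext i
  simpa using congrFun this i

/-- The translation vectors `(αᵢ, cᵢ)` span `ℂ × ℝ` over the reals. -/
theorem exists_coordinates (p : ℂ × ℝ) :
    ∃ t : Fin 3 → ℝ, p = ∑ i, t i • ((X.αvec i, X.cvec i) : ℂ × ℝ) := by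
  have hli : LinearIndependent ℝ (fun i : Fin 3 => ((X.αvec i, X.cvec i) : ℂ × ℝ)) := by
    rw [Fintype.linearIndependent_iff]
    intro r hr
    have := X.eq_zero_of_sum_eq_zero r
      (by simpa [Prod.fst_sum] using congrArg Prod.fst hr)
      (by simpa [Prod.snd_sum] using congrArg Prod.snd hr)
    exact fun i => congrFun this i
  have htop := hli.span_eq_top_of_card_eq_finrank (by simp [Module.finrank_prod])
  have hp : p ∈ Submodule.span ℝ (Set.range fun i : Fin 3 => ((X.αvec i, X.cvec i) : ℂ × ℝ)) :=
    htop ▸ Submodule.mem_top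
  obtain ⟨t, ht⟩ := (Submodule.mem_span_range_iff_exists_fun ℝ).mp hp
  exact ⟨t, ht.symm⟩

/-- The vectors `(αᵢ, cᵢ)` span a cocompact lattice of `ℂ × ℝ`, hence continuous periodic
functions are bounded. -/
theorem exists_bound_of_periodic {f : ℂ × ℝ → ℂ} (hf : Continuous f)
    (hper : ∀ i, Function.Periodic f (X.αvec i, X.cvec i)) : ∃ C, ∀ p, ‖f p‖ ≤ C := by
  let v : Fin 3 → ℂ × ℝ := fun i => (X.αvec i, X.cvec i)
  let F : (Fin 3 → ℝ) → ℂ := fun t => f (∑ i, t i • v i)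
  have hF : Continuous F := by fun_prop
  obtain ⟨C, hC⟩ := (isCompact_univ_pi fun _ : Fin 3 => isCompact_Icc (a := (0 : ℝ)) (b := 1)
    ).exists_bound_of_continuousOn hF.continuousOn
  refine ⟨C, fun p => ?_⟩
  obtain ⟨t, rfl⟩ := X.exists_coordinates p
  have key : f (∑ i, t i • v i) = F fun i => Int.fract (t i) := by
    have hz : Function.Periodic f (∑ i, ⌊t i⌋ • v i) := by
      rw [Fin.sum_univ_three]
      exact (((hper 0).zsmul _).add_period ((hper 1).zsmul _)).add_period ((hper 2).zsmul _)
    change _ = f _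
    rw [← hz (∑ i, Int.fract (t i) • v i), ← Finset.sum_add_distrib]
    congr 1
    refine Finset.sum_congr rfl fun i _ => ?_
    rw [← Int.cast_smul_eq_zsmul ℝ, ← add_smul, Int.fract_add_floor]
  change ‖f (∑ i, t i • v i)‖ ≤ C
  rw [key]
  exact hC _ fun i _ => ⟨Int.fract_nonneg _, (Int.fract_lt_one _).le⟩

theorem c_pos : 0 < X.c := zero_lt_one.trans X.one_lt_c

/-- The subgroup of `ℝ` generated by the `cᵢ` is stable under division by the unit `c > 1`, so
it contains arbitrarily small elements. -/
theorem dense_closure_cvec : Dense (AddSubgroup.closure (Set.range X.cvec) : Set ℝ) := by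
  set L := AddSubgroup.closure (Set.range X.cvec) with hL
  have hdiv : ∀ x ∈ L, X.c⁻¹ * x ∈ L := by
    intro x hx
    induction hx using AddSubgroup.closure_induction with
    | mem x hx =>
      obtain ⟨j, rfl⟩ := hx
      let B : Matrix (Fin 3) (Fin 3) ℤ := ((X.A⁻¹ : Matrix.SpecialLinearGroup (Fin 3) ℤ) :
        Matrix (Fin 3) (Fin 3) ℤ)
      have hBA : B * (X.A : Matrix (Fin 3) (Fin 3) ℤ) = 1 := by
        have : X.A⁻¹ * X.A = 1 := inv_mul_cancel _
        exact (Matrix.SpecialLinearGroup.coe_mul _ _).symm.trans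
          ((congrArg Subtype.val this).trans Matrix.SpecialLinearGroup.coe_one)
      have hB : B.map (Int.cast : ℤ → ℝ) *ᵥ X.cvec = X.c⁻¹ • X.cvec := by
        have h1 := congrArg (fun u => X.c⁻¹ • (B.map (Int.cast : ℤ → ℝ) *ᵥ u)) X.cvec_eigen
        have h2 : B.map (Int.cast : ℤ → ℝ) *
            (X.A : Matrix (Fin 3) (Fin 3) ℤ).map (Int.cast : ℤ → ℝ) = 1 := by
          have := congrArg (Int.castRingHom ℝ).mapMatrix hBA
          rwa [map_mul, map_one] at this
        simp only [Matrix.mulVec_mulVec, h2, Matrix.one_mulVec, Matrix.mulVec_smul] at h1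
        rw [smul_smul, inv_mul_cancel₀ X.c_pos.ne', one_smul] at h1
        exact h1.symm
      have h3 := congrFun hB j
      simp only [Matrix.mulVec, dotProduct, Matrix.map_apply, Pi.smul_apply, smul_eq_mul] at h3
      rw [← h3]
      refine AddSubgroup.sum_mem _ fun i _ => ?_
      rw [← zsmul_eq_mul]
      exact AddSubgroup.zsmul_mem _ (AddSubgroup.subset_closure (Set.mem_range_self i)) _
    | zero => simp
    | add x y _ _ hx hy => rw [mul_add]; exact add_mem hx hy
    | neg x _ hx => rw [mul_neg]; exact neg_mem hx
  have hpow : ∀ n : ℕ, ∀ x ∈ L, (X.c⁻¹) ^ n * x ∈ L := by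
    intro n
    induction n with
    | zero => simp
    | succ n ih => intro x hx; rw [pow_succ', mul_assoc]; exact hdiv _ (ih x hx)
  obtain ⟨x, hxL, hx⟩ : ∃ x ∈ L, 0 < x := by
    obtain ⟨i, hi⟩ := Function.ne_iff.mp X.cvec_ne_zero
    have hm : X.cvec i ∈ L := AddSubgroup.subset_closure ⟨i, rfl⟩
    rcases lt_or_gt_of_ne hi with h | h
    · exact ⟨_, neg_mem hm, by simpa using h⟩
    · exact ⟨_, hm, h⟩
  refine AddSubgroup.dense_of_not_isolated_zero L fun ε hε => ?_
  have hlim : Filter.Tendsto (fun n : ℕ => (X.c⁻¹) ^ n * x) Filter.atTop (nhds 0) := by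
    simpa using (tendsto_pow_atTop_nhds_zero_of_lt_one (inv_nonneg.mpr X.c_pos.le)
      (inv_lt_one_of_one_lt₀ X.one_lt_c)).mul_const x
  obtain ⟨n, hn⟩ := (hlim.eventually (gt_mem_nhds hε)).exists
  exact ⟨_, hpow n x hxL, mul_pos (pow_pos (inv_pos.mpr X.c_pos) n) hx, hn⟩

theorem const_of_periodic {f : ℝ → ℂ} (hf : Continuous f)
    (hper : ∀ i, Function.Periodic f (X.cvec i)) (x : ℝ) : f x = f 0 := by
  have hL : ∀ v ∈ AddSubgroup.closure (Set.range X.cvec), Function.Periodic f v := by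
    intro v hv
    induction hv using AddSubgroup.closure_induction with
    | mem v hv => obtain ⟨i, rfl⟩ := hv; exact hper i
    | zero => exact fun x => by simp
    | add u v _ _ hu hv => exact hu.add_period hv
    | neg u _ hu => exact hu.neg
  have : f = fun _ => f 0 := hf.ext_on X.dense_closure_cvec continuous_const
    fun v hv => by simpa using hL v hv 0
  exact congrFun this x

end InoueDatum

/-! ### Directional derivatives and periodic functions on `ℂ × H` -/

theorem isOpen_CxH : IsOpen CxH :=
  isOpen_lt continuous_const (Complex.continuous_im.comp continuous_snd)

theorem CxH_mem_nhds {p : ℂ × ℂ} (hp : p ∈ CxH) : CxH ∈ nhds p := isOpen_CxH.mem_nhds hp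

theorem mk_mem_CxH {z w : ℂ} (hw : 0 < w.im) : (z, w) ∈ CxH := hw

theorem contDiffAt_CxH {F : Type*} [NormedAddCommGroup F] [NormedSpace ℝ F] {f : ℂ × ℂ → F}
    (hf : ContDiffOn ℝ ∞ f CxH) {p : ℂ × ℂ} (hp : p ∈ CxH) : ContDiffAt ℝ ∞ f p :=
  hf.contDiffAt (CxH_mem_nhds hp)

theorem differentiableAt_CxH {F : Type*} [NormedAddCommGroup F] [NormedSpace ℝ F] {f : ℂ × ℂ → F}
    (hf : ContDiffOn ℝ ∞ f CxH) {p : ℂ × ℂ} (hp : p ∈ CxH) : DifferentiableAt ℝ f p :=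
  (contDiffAt_CxH hf hp).differentiableAt (by simp)

theorem smooth_fderiv_apply {F : Type*} [NormedAddCommGroup F] [NormedSpace ℝ F]
    {f : ℂ × ℂ → F} (hf : ContDiffOn ℝ ∞ f CxH) (v : ℂ × ℂ) :
    ContDiffOn ℝ ∞ (fun p => fderiv ℝ f p v) CxH :=
  (hf.fderiv_of_isOpen isOpen_CxH (by simp)).clm_apply contDiffOn_const

theorem fderiv_fderiv_comm {F : Type*} [NormedAddCommGroup F] [NormedSpace ℝ F]
    {f : ℂ × ℂ → F} (hf : ContDiffOn ℝ ∞ f CxH) {p : ℂ × ℂ} (hp : p ∈ CxH) (u v : ℂ × ℂ) :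
    fderiv ℝ (fun q => fderiv ℝ f q u) p v = fderiv ℝ (fun q => fderiv ℝ f q v) p u := by
  have h := (contDiffAt_CxH hf hp).isSymmSndFDerivAt (by
    simpa using WithTop.coe_le_coe.mpr (le_top (a := (2 : ℕ∞))))
  have hd : DifferentiableAt ℝ (fderiv ℝ f) p :=
    differentiableAt_CxH (hf.fderiv_of_isOpen (m := ∞) isOpen_CxH (by simp)) hp
  have key : ∀ a b : ℂ × ℂ, fderiv ℝ (fun q => fderiv ℝ f q a) p b
      = fderiv ℝ (fderiv ℝ f) p b a := by
    intro a b
    rw [fderiv_clm_apply hd (differentiableAt_const _)]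
    simp
  rw [key, key]
  exact h.eq _ _

theorem hasDerivAt_line {F : Type*} [NormedAddCommGroup F] [NormedSpace ℝ F] {f : ℂ × ℂ → F}
    {p v : ℂ × ℂ} {t : ℝ} (hf : DifferentiableAt ℝ f (p + t • v)) :
    HasDerivAt (fun s : ℝ => f (p + s • v)) (fderiv ℝ f (p + t • v) v) t := by
  have h1 : HasDerivAt (fun s : ℝ => p + s • v) v t := by
    simpa using ((hasDerivAt_id t).smul_const v).const_add p
  exact hf.hasFDerivAt.comp_hasDerivAt t h1

/-- A function that is bounded on a line and has constant derivative along it has derivative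
zero along it. -/
theorem eq_zero_of_bounded_of_fderiv_const {f : ℂ × ℂ → ℂ} {p v : ℂ × ℂ} {a : ℂ} {C : ℝ}
    (hf : ∀ t : ℝ, DifferentiableAt ℝ f (p + t • v))
    (ha : ∀ t : ℝ, fderiv ℝ f (p + t • v) v = a) (hC : ∀ t : ℝ, ‖f (p + t • v)‖ ≤ C) :
    a = 0 := by
  have hd : ∀ t : ℝ, HasDerivAt (fun s : ℝ => f (p + s • v) - s • a) 0 t := by
    intro t
    have h1 := hasDerivAt_line (hf t)
    rw [ha t] at h1
    simpa using h1.fun_sub ((hasDerivAt_id t).smul_const a)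
  have hconst : ∀ t : ℝ, f (p + t • v) - t • a = f (p + (0 : ℝ) • v) - (0 : ℝ) • a := fun t =>
    is_const_of_deriv_eq_zero (fun t => (hd t).differentiableAt) (fun t => (hd t).deriv) t 0
  by_contra hne
  have hpos : 0 < ‖a‖ := norm_pos_iff.mpr hne
  have hC0 : 0 ≤ C := (norm_nonneg _).trans (hC 0)
  set t : ℝ := (2 * C + 1) / ‖a‖ with ht
  have h2 : t • a = f (p + t • v) - f (p + (0 : ℝ) • v) := by
    have := hconst t
    rw [zero_smul ℝ a, sub_zero] at this
    rw [← this]; abel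
  have h3 : ‖t • a‖ = 2 * C + 1 := by
    rw [norm_smul, Real.norm_of_nonneg (by positivity), ht, div_mul_cancel₀ _ hpos.ne']
  have h4 := norm_sub_le (f (p + t • v)) (f (p + (0 : ℝ) • v))
  rw [← h2, h3] at h4
  linarith [hC t, hC 0]

namespace InoueDatum

variable (X : InoueDatum)

/-- A function on `ℂ × H` is lattice-periodic if it is invariant under the translations
`g₁`, `g₂`, `g₃`. -/
def LatticePeriodic {F : Type*} (f : ℂ × ℂ → F) : Prop :=
  ∀ p ∈ CxH, ∀ i, f (p + (X.αvec i, (X.cvec i : ℂ))) = f p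

variable {X}

theorem add_mem_CxH {p : ℂ × ℂ} (hp : p ∈ CxH) (i : Fin 3) :
    p + (X.αvec i, (X.cvec i : ℂ)) ∈ CxH := by
  simpa [CxH] using hp

theorem LatticePeriodic.fderiv_apply {F : Type*} [NormedAddCommGroup F] [NormedSpace ℝ F]
    {f : ℂ × ℂ → F} (hf : X.LatticePeriodic f) (v : ℂ × ℂ) :
    X.LatticePeriodic (fun p => fderiv ℝ f p v) := by
  intro p hp i
  have : (fun q => f (q + (X.αvec i, (X.cvec i : ℂ)))) =ᶠ[nhds p] f :=
    Filter.eventually_of_mem (CxH_mem_nhds hp) fun q hq => hf q hq i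
  simp only
  rw [← fderiv_comp_add_right, this.fderiv_eq]

/-- A continuous lattice-periodic function descends to the fibres of the mapping torus `S → S¹`,
which are compact three-dimensional tori. -/
theorem LatticePeriodic.bounded {f : ℂ × ℂ → ℂ} (hf : X.LatticePeriodic f)
    (hc : ContinuousOn f CxH) {y : ℝ} (hy : 0 < y) : ∃ C, ∀ p : ℂ × ℂ, p.2.im = y → ‖f p‖ ≤ C := by
  let F : ℂ × ℝ → ℂ := fun q => f (q.1, (q.2 : ℂ) + (y : ℂ) * Complex.I)
  have hmem : ∀ q : ℂ × ℝ, ((q.1, (q.2 : ℂ) + (y : ℂ) * Complex.I) : ℂ × ℂ) ∈ CxH := fun q => by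
    simpa [CxH] using hy
  have hF : Continuous F := hc.comp_continuous (by fun_prop) hmem
  obtain ⟨C, hC⟩ := X.exists_bound_of_periodic hF (fun i q => by
    have := hf _ (hmem q) i
    simp only [F, Prod.fst_add, Prod.snd_add]
    rw [← this]
    congr 1
    ext1 <;> (simp; try ring))
  refine ⟨C, fun p hp => ?_⟩
  have := hC (p.1, p.2.re)
  have h2 : (p.1, (p.2.re : ℂ) + (y : ℂ) * Complex.I) = p := by
    rw [← hp, Complex.re_add_im]
  simpa only [F, h2] using this

/-- The lattice acts on the real line of values of `Re w` with dense orbits. -/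
theorem LatticePeriodic.eq_of_const_fst {f : ℂ × ℂ → ℂ} (hf : X.LatticePeriodic f)
    (hc : ContinuousOn f CxH) (hz : ∀ p ∈ CxH, f p = f (0, p.2)) {p : ℂ × ℂ} (hp : p ∈ CxH) :
    f p = f (0, (p.2.im : ℂ) * Complex.I) := by
  have hmem : ∀ x : ℝ, ((0, (x : ℂ) + (p.2.im : ℂ) * Complex.I) : ℂ × ℂ) ∈ CxH := fun q => by
    simpa [CxH] using hp
  let F : ℝ → ℂ := fun x => f (0, (x : ℂ) + (p.2.im : ℂ) * Complex.I)
  have hF : Continuous F := hc.comp_continuous (by fun_prop) hmem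
  have := X.const_of_periodic hF (fun i x => by
    have h1 := hf _ (hmem x) i
    have h2 := hz _ (add_mem_CxH (X := X) (hmem x) i)
    rw [h1] at h2
    simp only [F]
    rw [h2]
    congr 1
    ext1 <;> (simp; try ring)) p.2.re
  rw [hz p hp]
  simpa [F] using this

end InoueDatum

theorem hasDerivAt_fst_comp {f : ℂ → ℂ × ℂ} {f' : ℂ × ℂ} {z : ℂ} (h : HasDerivAt f f' z) :
    HasDerivAt (fun x => (f x).1) f'.1 z := by
  exact (hasFDerivAt_fst (𝕜 := ℂ) (p := f z)).comp_hasDerivAt z h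

theorem hasDerivAt_snd_comp {f : ℂ → ℂ × ℂ} {f' : ℂ × ℂ} {z : ℂ} (h : HasDerivAt f f' z) :
    HasDerivAt (fun x => (f x).2) f'.2 z := by
  exact (hasFDerivAt_snd (𝕜 := ℂ) (p := f z)).comp_hasDerivAt z h

/-! ### Transformations preserving a nowhere vanishing `(2,0)`-form -/

/-- The value of the form `dz ∧ dw` on the vectors `u` and `v`. -/
def wedge (u v : ℂ × ℂ) : ℂ := u.1 * v.2 - u.2 * v.1

/-- `ψ` is a smooth self-map of `ℂ × H` that preserves the `(2,0)`-form `φ dz ∧ dw`. -/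
structure PreservesForm (φ : ℂ × ℂ → ℂ) (ψ : ℂ × ℂ → ℂ × ℂ) : Prop where
  mapsTo : ∀ p ∈ CxH, ψ p ∈ CxH
  smooth : ContDiffOn ℝ ∞ ψ CxH
  form : ∀ p ∈ CxH, ∀ u v,
    φ (ψ p) * wedge (fderiv ℝ ψ p u) (fderiv ℝ ψ p v) = φ p * wedge u v

namespace PreservesForm

variable {φ : ℂ × ℂ → ℂ} {ψ : ℂ × ℂ → ℂ × ℂ}

/-- A nonzero `(2,0)`-form determines the complex structure, so a map preserving it is
holomorphic. -/
theorem differentiableAt (hψ : PreservesForm φ ψ) (h0 : ∀ p ∈ CxH, φ p ≠ 0) {p : ℂ × ℂ}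
    (hp : p ∈ CxH) : DifferentiableAt ℂ ψ p := by
  set L := fderiv ℝ ψ p with hL
  have hform : ∀ u v, φ (ψ p) * wedge (L u) (L v) = φ p * wedge u v := hψ.form p hp
  have h1 := h0 _ (hψ.mapsTo p hp)
  have hker : ∀ ξ : ℂ × ℂ, (∀ v, wedge ξ (L v) = 0) → ξ = 0 := by
    intro ξ hξ
    by_contra hne
    have hpar : wedge (L (1, 0)) (L (0, 1)) = 0 := by
      have a := hξ (1, 0)
      have b := hξ (0, 1)
      simp only [wedge] at a b ⊢
      rcases Decidable.not_and_iff_or_not.mp (fun h : ξ.1 = 0 ∧ ξ.2 = 0 =>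
        hne (Prod.ext h.1 h.2)) with h | h
      · refine mul_left_cancel₀ h ?_
        linear_combination (L (0, 1)).1 * a * (-1) + (L (1, 0)).1 * b
      · refine mul_left_cancel₀ h ?_
        linear_combination (L (0, 1)).2 * a * (-1) + (L (1, 0)).2 * b
    have := hform (1, 0) (0, 1)
    rw [hpar] at this
    simp [wedge] at this
    exact h0 p hp this.symm
  have hlin : ∀ (c : ℂ) (u : ℂ × ℂ), L (c • u) = c • L u := by
    intro c u
    refine sub_eq_zero.mp (hker _ fun v => mul_left_cancel₀ h1 ?_)
    have a := hform (c • u) v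
    have b := hform u v
    simp only [wedge, Prod.fst_sub, Prod.snd_sub, Prod.smul_fst, Prod.smul_snd, smul_eq_mul]
      at a b ⊢
    linear_combination a - c * b
  rw [differentiableAt_iff_restrictScalars ℝ (differentiableAt_CxH hψ.smooth hp)]
  exact ⟨⟨{ toFun := L, map_add' := L.map_add, map_smul' := hlin }, L.continuous⟩, rfl⟩

theorem form_complex (hψ : PreservesForm φ ψ) (h0 : ∀ p ∈ CxH, φ p ≠ 0) {p : ℂ × ℂ}
    (hp : p ∈ CxH) (u v : ℂ × ℂ) :
    φ (ψ p) * wedge (fderiv ℂ ψ p u) (fderiv ℂ ψ p v) = φ p * wedge u v := by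
  have := hψ.form p hp u v
  rwa [(hψ.differentiableAt h0 hp).fderiv_restrictScalars ℝ] at this

theorem hasDerivAt_fst (hψ : PreservesForm φ ψ) (h0 : ∀ p ∈ CxH, φ p ≠ 0) {z w : ℂ}
    (hw : 0 < w.im) : HasDerivAt (fun ζ => ψ (ζ, w)) (fderiv ℂ ψ (z, w) (1, 0)) z :=
  (hψ.differentiableAt h0 (mk_mem_CxH hw)).hasFDerivAt.comp_hasDerivAt z
    ((hasDerivAt_id z).prodMk (hasDerivAt_const z w))

theorem hasDerivAt_snd (hψ : PreservesForm φ ψ) (h0 : ∀ p ∈ CxH, φ p ≠ 0) {z w : ℂ}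
    (hw : 0 < w.im) : HasDerivAt (fun s => ψ (z, s)) (fderiv ℂ ψ (z, w) (0, 1)) w :=
  (hψ.differentiableAt h0 (mk_mem_CxH hw)).hasFDerivAt.comp_hasDerivAt w
    ((hasDerivAt_const w z).prodMk (hasDerivAt_id w))

end PreservesForm

/-- An entire function with values in the upper half-plane is constant. -/
theorem const_of_entire_of_im_pos {f : ℂ → ℂ} (hf : Differentiable ℂ f) (him : ∀ z, 0 < (f z).im)
    (z w : ℂ) : f z = f w := by
  have hre : ∀ z, 1 ≤ ‖f z + Complex.I‖ := fun z => by
    have := Complex.abs_im_le_norm (f z + Complex.I)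
    have h2 := him z
    rw [abs_of_pos (by simp; linarith)] at this
    simp at this
    linarith
  have hne : ∀ z, f z + Complex.I ≠ 0 := fun z h => by
    have := hre z
    rw [h, norm_zero] at this
    linarith
  have hb := Differentiable.apply_eq_apply_of_bounded
    (f := fun z => (f z + Complex.I)⁻¹) ((hf.add_const _).inv hne)
    (isBounded_iff_forall_norm_le.mpr ⟨1, by
      rintro _ ⟨z, rfl⟩
      rw [norm_inv]
      exact inv_le_one_of_one_le₀ (hre z)⟩) z w
  simpa using hb

namespace PreservesForm

variable {φ : ℂ × ℂ → ℂ} {ψ : ℂ × ℂ → ℂ × ℂ}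

theorem snd_eq (hψ : PreservesForm φ ψ) (h0 : ∀ p ∈ CxH, φ p ≠ 0) (z : ℂ) {w : ℂ}
    (hw : 0 < w.im) : (ψ (z, w)).2 = (ψ (0, w)).2 :=
  const_of_entire_of_im_pos (f := fun ζ => (ψ (ζ, w)).2)
    (fun _ => (hψ.hasDerivAt_fst h0 hw).differentiableAt.snd)
    (fun ζ => hψ.mapsTo (ζ, w) hw) z 0

theorem hasDerivAt_base (hψ : PreservesForm φ ψ) (h0 : ∀ p ∈ CxH, φ p ≠ 0) (z : ℂ) {w : ℂ}
    (hw : 0 < w.im) :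
    HasDerivAt (fun s => (ψ (0, s)).2) (fderiv ℂ ψ (z, w) (0, 1)).2 w := by
  have h := hasDerivAt_snd_comp (hψ.hasDerivAt_snd h0 (z := z) hw)
  refine h.congr_of_eventuallyEq ?_
  filter_upwards [(isOpen_lt continuous_const Complex.continuous_im).mem_nhds hw] with s hs
  exact (hψ.snd_eq h0 z hs).symm

theorem jacobian (hψ : PreservesForm φ ψ) (h0 : ∀ p ∈ CxH, φ p ≠ 0) (z : ℂ) {w : ℂ}
    (hw : 0 < w.im) :
    φ (ψ (z, w)) * (deriv (fun ζ => (ψ (ζ, w)).1) z * deriv (fun s => (ψ (0, s)).2) w)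
      = φ (z, w) := by
  have h := hψ.form_complex h0 (mk_mem_CxH (z := z) hw) (1, 0) (0, 1)
  have h1 := (hψ.hasDerivAt_fst h0 (z := z) hw)
  have h2 : (fderiv ℂ ψ (z, w) (1, 0)).2 = 0 := by
    rw [← (hasDerivAt_snd_comp h1).deriv, show (fun ζ => (ψ (ζ, w)).2) = fun _ => (ψ (0, w)).2 from
      funext fun ζ => hψ.snd_eq h0 ζ hw, deriv_const]
  rw [(hasDerivAt_fst_comp h1).deriv, (hψ.hasDerivAt_base h0 z hw).deriv]
  simpa [wedge, h2] using h

/-- If the coefficient `φ` is bounded above and below on the sets `Im w = const`, the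
restriction of `ψ` to a fibre `ℂ × {w}` is an entire function with bounded derivative. -/
theorem deriv_fst_eq (hψ : PreservesForm φ ψ) (h0 : ∀ p ∈ CxH, φ p ≠ 0)
    (hb : ∀ y : ℝ, 0 < y → ∃ C, ∀ p : ℂ × ℂ, p.2.im = y → ‖φ p‖ ≤ C)
    (hb' : ∀ y : ℝ, 0 < y → ∃ C, ∀ p : ℂ × ℂ, p.2.im = y → ‖(φ p)⁻¹‖ ≤ C)
    (z : ℂ) {w : ℂ} (hw : 0 < w.im) :
    deriv (fun ζ => (ψ (ζ, w)).1) z = deriv (fun ζ => (ψ (ζ, w)).1) 0 := by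
  set F : ℂ → ℂ := fun ζ => (ψ (ζ, w)).1 with hF
  have hdiff : Differentiable ℂ F := fun _ => (hψ.hasDerivAt_fst h0 hw).differentiableAt.fst
  obtain ⟨C, hC⟩ := hb _ hw
  obtain ⟨C', hC'⟩ := hb' _ (show 0 < (ψ (0, w)).2.im from hψ.mapsTo (0, w) hw)
  set m' := deriv (fun s => (ψ (0, s)).2) w with hm'
  have hm0 : m' ≠ 0 := fun h => h0 _ (mk_mem_CxH (z := 0) hw) (by
    rw [← hψ.jacobian h0 0 hw, ← hm', h]; simp)
  refine Differentiable.apply_eq_apply_of_bounded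
    (hdiff.contDiff (n := 2)).differentiable_deriv_two ?_ z 0
  refine isBounded_iff_forall_norm_le.mpr ⟨C * C' * ‖m'‖⁻¹, ?_⟩
  rintro _ ⟨ζ, rfl⟩
  have hj := hψ.jacobian h0 ζ hw
  have hne := h0 _ (hψ.mapsTo (ζ, w) hw)
  have : deriv F ζ = φ (ζ, w) * (φ (ψ (ζ, w)))⁻¹ * m'⁻¹ := by
    rw [← hj]; field_simp; rfl
  rw [this, norm_mul, norm_mul, norm_inv m']
  have hi := hC' (ψ (ζ, w)) (by rw [hψ.snd_eq h0 ζ hw])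
  gcongr
  · exact (norm_nonneg _).trans (hC (ζ, w) rfl)
  · exact hC (ζ, w) rfl

/-- `ψ` acts on the fibres `ℂ × {w}` by affine maps. -/
theorem fst_eq (hψ : PreservesForm φ ψ) (h0 : ∀ p ∈ CxH, φ p ≠ 0)
    (hb : ∀ y : ℝ, 0 < y → ∃ C, ∀ p : ℂ × ℂ, p.2.im = y → ‖φ p‖ ≤ C)
    (hb' : ∀ y : ℝ, 0 < y → ∃ C, ∀ p : ℂ × ℂ, p.2.im = y → ‖(φ p)⁻¹‖ ≤ C)
    (z : ℂ) {w : ℂ} (hw : 0 < w.im) :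
    (ψ (z, w)).1 = deriv (fun ζ => (ψ (ζ, w)).1) 0 * z + (ψ (0, w)).1 := by
  set F : ℂ → ℂ := fun ζ => (ψ (ζ, w)).1 with hF
  have hdiff : Differentiable ℂ F := fun _ => (hψ.hasDerivAt_fst h0 hw).differentiableAt.fst
  have hd : ∀ ζ, HasDerivAt (fun ζ => F ζ - deriv F 0 * ζ) 0 ζ := fun ζ => by
    have h1 := (hdiff ζ).hasDerivAt.fun_sub ((hasDerivAt_id ζ).const_mul (deriv F 0))
    rw [show deriv F ζ = deriv F 0 from hψ.deriv_fst_eq h0 hb hb' ζ hw] at h1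
    simpa using h1
  have := is_const_of_deriv_eq_zero (fun ζ => (hd ζ).differentiableAt) (fun ζ => (hd ζ).deriv) z 0
  simp only [mul_zero, sub_zero] at this
  linear_combination this

end PreservesForm

/-! ### Homogeneous `(2,0)`-forms depend only on `Im w` -/

theorem fderiv_add_of_invariant {F : Type*} [NormedAddCommGroup F] [NormedSpace ℝ F]
    {f : ℂ × ℂ → F} {a : ℂ × ℂ} (h : ∀ q ∈ CxH, f (q + a) = f q) {p : ℂ × ℂ} (hp : p ∈ CxH) :
    fderiv ℝ f (p + a) = fderiv ℝ f p := by
  have : (fun q => f (q + a)) =ᶠ[nhds p] f :=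
    Filter.eventually_of_mem (CxH_mem_nhds hp) fun q hq => h q hq
  rw [← fderiv_comp_add_right, this.fderiv_eq]

/-- The derivative of `log φ` in the direction `v`. -/
noncomputable def dlog (φ : ℂ × ℂ → ℂ) (v p : ℂ × ℂ) : ℂ := fderiv ℝ φ p v / φ p

theorem smooth_dlog {φ : ℂ × ℂ → ℂ} (hφ : ContDiffOn ℝ ∞ φ CxH) (h0 : ∀ p ∈ CxH, φ p ≠ 0)
    (v : ℂ × ℂ) : ContDiffOn ℝ ∞ (dlog φ v) CxH :=
  ((smooth_fderiv_apply hφ v).mul (hφ.inv h0)).congr fun _ _ => div_eq_mul_inv _ _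

/-- The form `d log φ` is closed. -/
theorem fderiv_dlog_comm {φ : ℂ × ℂ → ℂ} (hφ : ContDiffOn ℝ ∞ φ CxH) (h0 : ∀ p ∈ CxH, φ p ≠ 0)
    (u v : ℂ × ℂ) {p : ℂ × ℂ} (hp : p ∈ CxH) :
    fderiv ℝ (dlog φ u) p v = fderiv ℝ (dlog φ v) p u := by
  have key : ∀ a b : ℂ × ℂ, fderiv ℝ (fun q => fderiv ℝ φ q a) p b
      = dlog φ a p * fderiv ℝ φ p b + φ p * fderiv ℝ (dlog φ a) p b := by
    intro a b
    have h1 : (fun q => fderiv ℝ φ q a) =ᶠ[nhds p] dlog φ a * φ :=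
      Filter.eventually_of_mem (CxH_mem_nhds hp) fun q hq => by
        simp [dlog, div_mul_cancel₀ _ (h0 q hq)]
    rw [h1.fderiv_eq, fderiv_mul (differentiableAt_CxH (smooth_dlog hφ h0 a) hp)
      (differentiableAt_CxH hφ hp)]
    simp
  have h2 := fderiv_fderiv_comm hφ hp u v
  rw [key, key] at h2
  have h3 : ∀ a b : ℂ × ℂ, dlog φ a p * fderiv ℝ φ p b = φ p * (dlog φ a p * dlog φ b p) := by
    intro a b
    simp only [dlog]
    field_simp [h0 p hp]
  rw [h3, h3, mul_comm (dlog φ u p)] at h2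
  exact mul_left_cancel₀ (h0 p hp) (add_left_cancel h2)

/-- The form `φ dz ∧ dw` on `ℂ × H` is smooth and nowhere zero, descends to the Inoue surface,
and is preserved by a family of maps that acts simply transitively. -/
structure HomogeneousForm (X : InoueDatum) (φ : ℂ × ℂ → ℂ) : Prop where
  smooth : ContDiffOn ℝ ∞ φ CxH
  ne_zero : ∀ p ∈ CxH, φ p ≠ 0
  periodic : X.LatticePeriodic φ
  scaling : ∀ p ∈ CxH, φ (X.α * p.1, X.c * p.2) * (X.α * X.c) = φ p
  transitive : ∀ p ∈ CxH, ∀ q ∈ CxH, ∃ ψ, PreservesForm φ ψ ∧ ψ p = q ∧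
    ((∃ r ∈ CxH, ψ r = r) → ∀ r ∈ CxH, ψ r = r)

namespace HomogeneousForm

variable {X : InoueDatum} {φ : ℂ × ℂ → ℂ}

theorem bounded (H : HomogeneousForm X φ) (y : ℝ) (hy : 0 < y) :
    ∃ C, ∀ p : ℂ × ℂ, p.2.im = y → ‖φ p‖ ≤ C :=
  H.periodic.bounded H.smooth.continuousOn hy

theorem bounded_inv (H : HomogeneousForm X φ) (y : ℝ) (hy : 0 < y) :
    ∃ C, ∀ p : ℂ × ℂ, p.2.im = y → ‖(φ p)⁻¹‖ ≤ C :=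
  InoueDatum.LatticePeriodic.bounded (X := X) (f := fun p => (φ p)⁻¹)
    (fun p hp i => by simp only [H.periodic p hp i])
    (H.smooth.continuousOn.inv₀ H.ne_zero) hy

/-- The maps of the family that stabilise a fibre `ℂ × {w}` act on it by translations: an affine
map `z ↦ f z + h` with `f ≠ 1` has a fixed point. -/
theorem exists_translation (H : HomogeneousForm X φ) (h : ℂ) {w : ℂ} (hw : 0 < w.im) :
    ∃ ρ : ℂ, ∀ z, φ (z + h, w) * ρ = φ (z, w) := by
  obtain ⟨ψ, hψ, hq, hfix⟩ := H.transitive (0, w) hw (h, w) hw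
  set f := deriv (fun ζ => (ψ (ζ, w)).1) 0 with hf
  have hval : ∀ z, ψ (z, w) = (f * z + h, w) := by
    intro z
    have h1 := hψ.fst_eq H.ne_zero H.bounded H.bounded_inv z hw
    have h2 := hψ.snd_eq H.ne_zero z hw
    rw [hq] at h1 h2
    exact Prod.ext h1 h2
  have hf1 : f = 1 := by
    by_contra hne
    have hne' : 1 - f ≠ 0 := sub_ne_zero.mpr (Ne.symm hne)
    have hall := hfix ⟨(h / (1 - f), w), hw, by
      rw [hval]
      ext1
      · simp only
        field_simp
        ring
      · rfl⟩
    have a := congrArg Prod.fst ((hval 0).symm.trans (hall (0, w) hw))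
    have b := congrArg Prod.fst ((hval 1).symm.trans (hall (1, w) hw))
    simp only at a b
    exact hne (by linear_combination b - a)
  refine ⟨deriv (fun s => (ψ (0, s)).2) w, fun z => ?_⟩
  have hj := hψ.jacobian H.ne_zero z hw
  rw [hψ.deriv_fst_eq H.ne_zero H.bounded H.bounded_inv z hw, ← hf, hf1, hval z, hf1] at hj
  simpa using hj

theorem dlog_periodic (H : HomogeneousForm X φ) (v : ℂ × ℂ) : X.LatticePeriodic (dlog φ v) :=
  fun p hp i => by
    have := H.periodic.fderiv_apply v p hp i
    simp only at this
    simp only [dlog, this, H.periodic p hp i]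

theorem dlog_vertical_eq (H : HomogeneousForm X φ) (v : ℂ) {p : ℂ × ℂ} (hp : p ∈ CxH) :
    dlog φ (v, 0) p = dlog φ (v, 0) (0, p.2) := by
  obtain ⟨z, w⟩ := p
  have hw : 0 < w.im := hp
  obtain ⟨ρ, hρ⟩ := H.exists_translation z hw
  have hd : ∀ ζ : ℂ, HasDerivAt (fun s : ℝ => φ ((ζ, w) + s • ((v, 0) : ℂ × ℂ)))
      (fderiv ℝ φ (ζ, w) (v, 0)) 0 := fun ζ => by
    simpa using hasDerivAt_line (f := φ) (p := (ζ, w)) (v := (v, 0)) (t := 0)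
      (by simpa using differentiableAt_CxH H.smooth (mk_mem_CxH (z := ζ) hw))
  have h1 := (hd z).mul_const ρ
  have h2 : (fun s : ℝ => φ ((z, w) + s • ((v, 0) : ℂ × ℂ)) * ρ)
      = fun s : ℝ => φ ((0, w) + s • ((v, 0) : ℂ × ℂ)) := by
    funext s
    have := hρ (s • v)
    simpa [add_comm] using this
  rw [h2] at h1
  have h3 := h1.unique (hd 0)
  have h4 := hρ 0
  have h5 := H.ne_zero _ (mk_mem_CxH (z := z) hw)
  have h6 := H.ne_zero _ (mk_mem_CxH (z := 0) hw)
  rw [zero_add] at h4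
  simp only [dlog]
  rw [div_eq_div_iff h5 h6, ← h3, ← h4]
  ring

theorem dlog_vertical_eq_im (H : HomogeneousForm X φ) (v : ℂ) {p : ℂ × ℂ} (hp : p ∈ CxH) :
    dlog φ (v, 0) p = dlog φ (v, 0) (0, (p.2.im : ℂ) * Complex.I) :=
  (H.dlog_periodic (v, 0)).eq_of_const_fst (smooth_dlog H.smooth H.ne_zero _).continuousOn
    (fun _ hq => H.dlog_vertical_eq v hq) hp

/-- By closedness of `d log φ`, the derivative in the direction of `Im w` of the vertical
component of `d log φ` is the derivative along the fibres of a bounded function; being constant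
on each fibre, it vanishes. -/
theorem fderiv_dlog_vertical (H : HomogeneousForm X φ) (v : ℂ) {w : ℂ} (hw : 0 < w.im) :
    fderiv ℝ (dlog φ (v, 0)) (0, w) (0, Complex.I) = 0 := by
  obtain ⟨C, hC⟩ := (H.dlog_periodic (0, Complex.I)).bounded
    (smooth_dlog H.smooth H.ne_zero _).continuousOn hw
  have hmem : ∀ t : ℝ, ((0, w) + t • ((v, 0) : ℂ × ℂ)) ∈ CxH := fun t => by
    simpa [CxH] using hw
  refine eq_zero_of_bounded_of_fderiv_const (f := dlog φ (0, Complex.I)) (p := (0, w))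
    (v := (v, 0)) (C := C)
    (fun t => differentiableAt_CxH (smooth_dlog H.smooth H.ne_zero _) (hmem t)) ?_
    (fun t => hC _ (by simp))
  intro t
  rw [fderiv_dlog_comm H.smooth H.ne_zero _ _ (hmem t)]
  rw [fderiv_add_of_invariant (a := t • ((v, 0) : ℂ × ℂ)) _ (mk_mem_CxH hw)]
  intro q hq
  rw [H.dlog_vertical_eq v hq, H.dlog_vertical_eq v (p := q + _) (by simpa [CxH] using hq)]
  simp

theorem dlog_vertical_const (H : HomogeneousForm X φ) (v : ℂ) {p : ℂ × ℂ} (hp : p ∈ CxH) :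
    dlog φ (v, 0) p = dlog φ (v, 0) (0, Complex.I) := by
  have hd : ∀ y ∈ Set.Ioi (0 : ℝ), HasDerivAt
      (fun y : ℝ => dlog φ (v, 0) (0, (y : ℂ) * Complex.I)) 0 y := by
    intro y hy
    have hm : ((0, (y : ℂ) * Complex.I) : ℂ × ℂ) ∈ CxH := by simpa [CxH] using hy
    have h1 := hasDerivAt_line (f := dlog φ (v, 0)) (p := 0) (v := (0, Complex.I)) (t := y)
      (differentiableAt_CxH (smooth_dlog H.smooth H.ne_zero _) (by simpa using hm))
    have h2 := H.fderiv_dlog_vertical v (show 0 < ((y : ℂ) * Complex.I).im by simpa using hy)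
    simpa [h2] using h1
  have := isOpen_Ioi.is_const_of_deriv_eq_zero isPreconnected_Ioi
    (fun y hy => (hd y hy).differentiableAt.differentiableWithinAt)
    (fun y hy => (hd y hy).deriv) (show p.2.im ∈ Set.Ioi (0 : ℝ) from hp)
    (Set.mem_Ioi.mpr (one_pos (α := ℝ)))
  rw [H.dlog_vertical_eq_im v hp, this]
  simp

theorem scale_mem {p : ℂ × ℂ} (hp : p ∈ CxH) : ((X.α * p.1, (X.c : ℂ) * p.2) : ℂ × ℂ) ∈ CxH := by
  have : 0 < X.c * p.2.im := mul_pos X.c_pos hp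
  simpa [CxH] using this

/-- The vertical component of `d log φ` is a constant real-linear form that is invariant under
multiplication by `α ≠ 1`. -/
theorem dlog_vertical_zero (H : HomogeneousForm X φ) (v : ℂ) {p : ℂ × ℂ} (hp : p ∈ CxH) :
    dlog φ (v, 0) p = 0 := by
  have hscale : ∀ v : ℂ, dlog φ (X.α * v, 0) (0, Complex.I) = dlog φ (v, 0) (0, Complex.I) := by
    intro v
    have hI : ((0, Complex.I) : ℂ × ℂ) ∈ CxH := by simp [CxH]
    have hcI : ((0, (X.c : ℂ) * Complex.I) : ℂ × ℂ) ∈ CxH := by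
      simpa using scale_mem (X := X) hI
    rw [← H.dlog_vertical_const (X.α * v) hcI]
    have h1 := (hasDerivAt_line (f := φ) (p := (0, (X.c : ℂ) * Complex.I)) (v := (X.α * v, 0))
      (t := 0) (by simpa using differentiableAt_CxH H.smooth hcI)).mul_const (X.α * X.c)
    have h2 := hasDerivAt_line (f := φ) (p := (0, Complex.I)) (v := (v, 0))
      (t := 0) (by simpa using differentiableAt_CxH H.smooth hI)
    have h3 : (fun s : ℝ => φ ((0, (X.c : ℂ) * Complex.I) + s • ((X.α * v, 0) : ℂ × ℂ))
        * (X.α * X.c)) = fun s : ℝ => φ ((0, Complex.I) + s • ((v, 0) : ℂ × ℂ)) := by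
      funext s
      have hm : ((0, Complex.I) + s • ((v, 0) : ℂ × ℂ)) ∈ CxH := by simp [CxH]
      rw [← H.scaling _ hm]
      simp [mul_left_comm]
    rw [h3] at h1
    have h4 := h1.unique h2
    have h5 := H.scaling _ hI
    simp only [zero_smul, add_zero, mul_zero] at h4 h5
    have h6 := H.ne_zero _ hI
    have h7 := H.ne_zero _ hcI
    simp only [dlog]
    rw [div_eq_div_iff h7 h6, ← h4, ← h5]
    ring
  rw [H.dlog_vertical_const v hp]
  have hne : X.α - 1 ≠ 0 := sub_ne_zero.mpr X.α_ne_one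
  have h1 := hscale ((X.α - 1)⁻¹ * v)
  have h2 : ((X.α * ((X.α - 1)⁻¹ * v), 0) : ℂ × ℂ) = ((X.α - 1)⁻¹ * v, 0) + (v, 0) := by
    ext1
    · simp only [Prod.fst_add]
      field_simp
      ring
    · simp
  rw [h2] at h1
  simp only [dlog, map_add, add_div] at h1
  exact add_eq_left.mp h1

theorem eq_of_im (H : HomogeneousForm X φ) {p : ℂ × ℂ} (hp : p ∈ CxH) :
    φ p = φ (0, (p.2.im : ℂ) * Complex.I) := by
  refine H.periodic.eq_of_const_fst H.smooth.continuousOn (fun q hq => ?_) hp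
  have hm : ∀ t : ℝ, ((0, q.2) + t • ((q.1, 0) : ℂ × ℂ)) ∈ CxH := fun t => by
    simpa [CxH] using hq
  have hd : ∀ t : ℝ, HasDerivAt (fun s : ℝ => φ ((0, q.2) + s • ((q.1, 0) : ℂ × ℂ))) 0 t := by
    intro t
    have h1 := hasDerivAt_line (differentiableAt_CxH H.smooth (hm t))
    have h2 := H.dlog_vertical_zero q.1 (hm t)
    rw [dlog, div_eq_zero_iff, or_iff_left (H.ne_zero _ (hm t))] at h2
    rwa [h2] at h1
  have := is_const_of_deriv_eq_zero (fun t => (hd t).differentiableAt) (fun t => (hd t).deriv) 1 0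
  simpa using this

end HomogeneousForm

/-! ### The logarithmic derivative of the coefficient -/

theorem hasDerivAt_im_comp {f : ℝ → ℂ} {f' m' : ℂ} {m : ℂ → ℂ} {w : ℂ}
    (hf : HasDerivAt f f' (m w).im) (hm : HasDerivAt m m' w) (v : ℂ) :
    HasDerivAt (fun t : ℝ => f (m (w + t * v)).im) ((m' * v).im * f') 0 := by
  have h1 : HasDerivAt (fun t : ℝ => w + t * v) v 0 := by
    simpa using (((hasDerivAt_id (0 : ℝ)).ofReal_comp).mul_const v).const_add w
  have hm' : HasDerivAt m m' (w + ((0 : ℝ) : ℂ) * v) := by simpa using hm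
  have h2 : HasDerivAt (fun t : ℝ => m (w + t * v)) (m' * v) 0 := hm'.comp (0 : ℝ) h1
  have h3 : HasDerivAt (fun t : ℝ => (m (w + t * v)).im) (m' * v).im 0 :=
    Complex.imCLM.hasFDerivAt.comp_hasDerivAt (0 : ℝ) h2
  have hf' : HasDerivAt f f' (m (w + ((0 : ℝ) : ℂ) * v)).im := by simpa using hf
  exact HasDerivAt.scomp (0 : ℝ) hf' h3

/-- The result of applying `∂/∂w̄` to an identity `f (Im m) K = g (Im w)` with `m` and `K`
holomorphic. -/
theorem deriv_mul_conj_eq {f g : ℝ → ℂ} {m K : ℂ → ℂ} {w f' g' m' : ℂ}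
    (hf : HasDerivAt f f' (m w).im) (hg : HasDerivAt g g' w.im) (hm : HasDerivAt m m' w)
    (hK : DifferentiableAt ℂ K w) (h : ∀ᶠ s in nhds w, f (m s).im * K s = g s.im) :
    f' * (starRingEnd ℂ) m' * K w = g' := by
  have key : ∀ v : ℂ, (m' * v).im * f' * K w + f (m w).im * (deriv K w * v) = v.im * g' := by
    intro v
    have h1 : HasDerivAt (fun t : ℝ => w + t * v) v 0 := by
      simpa using (((hasDerivAt_id (0 : ℝ)).ofReal_comp).mul_const v).const_add w
    have h2 : HasDerivAt (fun t : ℝ => K (w + t * v)) (deriv K w * v) 0 := by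
      have hK' : HasDerivAt K (deriv K w) (w + ((0 : ℝ) : ℂ) * v) := by simpa using hK.hasDerivAt
      exact hK'.comp (0 : ℝ) h1
    have h3 := (hasDerivAt_im_comp hf hm v).mul h2
    have h4 := hasDerivAt_im_comp (m := id) hg (hasDerivAt_id w) v
    have h5 : Filter.Tendsto (fun t : ℝ => w + t * v) (nhds 0) (nhds w) := by
      simpa using h1.continuousAt.tendsto
    have h6 := h3.congr_of_eventuallyEq ((h5.eventually h).mono fun t ht => ht.symm)
    simpa using h6.unique h4
  have a := key 1
  have b := key Complex.I
  have hc : (starRingEnd ℂ) m' = (m'.re : ℂ) - m'.im * Complex.I := by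
    apply Complex.ext <;> simp
  simp only [mul_one, Complex.one_im, Complex.ofReal_zero, zero_mul, Complex.mul_I_im,
    Complex.I_im, Complex.ofReal_one, one_mul] at a b
  rw [hc]
  linear_combination b - Complex.I * a

namespace HomogeneousForm

variable {X : InoueDatum} {φ : ℂ × ℂ → ℂ}

theorem dlog_eq_of_im (H : HomogeneousForm X φ) (v : ℂ × ℂ) {p : ℂ × ℂ} (hp : p ∈ CxH) :
    dlog φ v p = dlog φ v (0, (p.2.im : ℂ) * Complex.I) := by
  have hp' : ((0, (p.2.im : ℂ) * Complex.I) : ℂ × ℂ) ∈ CxH := by simpa [CxH] using hp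
  have h1 := fderiv_add_of_invariant (f := φ) (a := (p.1, (p.2.re : ℂ))) (fun q hq => by
    rw [H.eq_of_im hq, H.eq_of_im (p := q + _) (by simpa [CxH] using hq)]
    simp) hp'
  have h2 : ((0, (p.2.im : ℂ) * Complex.I) : ℂ × ℂ) + (p.1, (p.2.re : ℂ)) = p := by
    ext1
    · simp
    · simp only [Prod.snd_add]
      rw [add_comm, Complex.re_add_im]
  rw [h2] at h1
  simp only [dlog]
  rw [h1, H.eq_of_im hp]

theorem dlog_re (H : HomogeneousForm X φ) {p : ℂ × ℂ} (hp : p ∈ CxH) : dlog φ (0, 1) p = 0 := by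
  have hm : ∀ t : ℝ, (p + t • ((0, 1) : ℂ × ℂ)) ∈ CxH := fun t => by simpa [CxH] using hp
  have h1 := hasDerivAt_line (f := φ) (p := p) (v := (0, 1)) (t := 0)
    (differentiableAt_CxH H.smooth (hm 0))
  have h2 : (fun s : ℝ => φ (p + s • ((0, 1) : ℂ × ℂ))) = fun _ => φ p := by
    funext s
    rw [H.eq_of_im (hm s), H.eq_of_im hp]
    simp
  rw [h2] at h1
  have h3 := h1.unique (hasDerivAt_const _ _)
  simp only [zero_smul, add_zero] at h3
  simp [dlog, h3]

/-- The function `φ` as a function of `y = Im w`. -/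
def profile (φ : ℂ × ℂ → ℂ) (y : ℝ) : ℂ := φ (0, (y : ℂ) * Complex.I)

/-- The logarithmic derivative of `φ` as a function of `y = Im w`. -/
noncomputable def logDer (φ : ℂ × ℂ → ℂ) (y : ℝ) : ℂ :=
  dlog φ (0, Complex.I) (0, (y : ℂ) * Complex.I)

theorem mul_I_mem {y : ℝ} (hy : 0 < y) : ((0, (y : ℂ) * Complex.I) : ℂ × ℂ) ∈ CxH := by
  simpa [CxH] using hy

theorem profile_ne_zero (H : HomogeneousForm X φ) {y : ℝ} (hy : 0 < y) : profile φ y ≠ 0 :=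
  H.ne_zero _ (mul_I_mem hy)

theorem hasDerivAt_profile (H : HomogeneousForm X φ) {y : ℝ} (hy : 0 < y) :
    HasDerivAt (profile φ) (logDer φ y * profile φ y) y := by
  have h1 := hasDerivAt_line (f := φ) (p := 0) (v := (0, Complex.I)) (t := y)
    (differentiableAt_CxH H.smooth (by simpa using mul_I_mem hy))
  have h2 : logDer φ y * profile φ y = fderiv ℝ φ (0, (y : ℂ) * Complex.I) (0, Complex.I) :=
    div_mul_cancel₀ _ (H.profile_ne_zero hy)
  rw [h2]
  simp only [zero_add, Prod.smul_mk, smul_zero, Complex.real_smul] at h1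
  exact h1

theorem hasDerivAt_logDer (H : HomogeneousForm X φ) {y : ℝ} (hy : 0 < y) :
    HasDerivAt (logDer φ)
      (fderiv ℝ (dlog φ (0, Complex.I)) (0, (y : ℂ) * Complex.I) (0, Complex.I)) y := by
  have h1 := hasDerivAt_line (f := dlog φ (0, Complex.I)) (p := 0) (v := (0, Complex.I)) (t := y)
    (differentiableAt_CxH (smooth_dlog H.smooth H.ne_zero _) (by simpa using mul_I_mem hy))
  simp only [zero_add, Prod.smul_mk, smul_zero, Complex.real_smul] at h1
  exact h1

theorem profile_scaling (H : HomogeneousForm X φ) {y : ℝ} (hy : 0 < y) :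
    profile φ (X.c * y) * (X.α * X.c) = profile φ y := by
  have := H.scaling _ (mul_I_mem hy)
  simpa [profile, mul_assoc] using this

theorem logDer_scaling (H : HomogeneousForm X φ) {y : ℝ} (hy : 0 < y) :
    logDer φ (X.c * y) * X.c = logDer φ y := by
  have hcy : 0 < X.c * y := mul_pos X.c_pos hy
  have h1 : HasDerivAt (fun t : ℝ => profile φ (X.c * t) * (X.α * X.c)) _ y :=
    (HasDerivAt.scomp y (H.hasDerivAt_profile hcy)
      (by simpa using (hasDerivAt_id y).const_mul X.c)).mul_const (X.α * X.c : ℂ)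
  have h2 := h1.congr_of_eventuallyEq (f₁ := profile φ) (by
    filter_upwards [Ioi_mem_nhds hy] with t ht
    exact (H.profile_scaling ht).symm)
  have h3 := h2.unique (H.hasDerivAt_profile hy)
  rw [← H.profile_scaling hy] at h3
  have h4 := H.profile_ne_zero hcy
  have h5 := X.α_ne_zero
  have h6 := X.c_ne_zero
  refine mul_right_cancel₀ (mul_ne_zero h4 (mul_ne_zero h5 h6)) ?_
  rw [← h3, Complex.real_smul]
  ring

/-- A map `ψ` of the family covers a holomorphic self-map `m` of the half-plane. Applying
`∂/∂w̄` to the invariance of `φ dz ∧ dw` gives the invariance of `ℓ(Im w) dw̄` under `m`, where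
`ℓ` is the logarithmic derivative of `φ`; the derivative of the latter is the invariance of
`ℓ'(Im w) dw ∧ dw̄`. -/
theorem exists_logDer_deriv_eq (H : HomogeneousForm X φ) {y Y : ℝ} (hy : 0 < y) (hY : 0 < Y) :
    ∃ r : ℝ, deriv (logDer φ) Y * r = deriv (logDer φ) y := by
  obtain ⟨ψ, hψ, hq, -⟩ := H.transitive _ (mul_I_mem hy) _ (mul_I_mem hY)
  set U : Set ℂ := {w | 0 < w.im} with hU
  have hUo : IsOpen U := isOpen_lt continuous_const Complex.continuous_im
  set m : ℂ → ℂ := fun s => (ψ (0, s)).2 with hm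
  have hmU : ∀ w ∈ U, 0 < (m w).im := fun w hw => hψ.mapsTo (0, w) hw
  have hmd : DifferentiableOn ℂ m U := fun w hw =>
    (hψ.hasDerivAt_base H.ne_zero 0 hw).differentiableAt.differentiableWithinAt
  have hmd' : DifferentiableOn ℂ (deriv m) U := hmd.deriv hUo
  have hm1 : ∀ w ∈ U, HasDerivAt m (deriv m w) w := fun w hw =>
    (hmd.differentiableAt (hUo.mem_nhds hw)).hasDerivAt
  set J : ℂ → ℂ := fun w => ((ψ (1, w)).1 - (ψ (0, w)).1) * deriv m w with hJ
  have hJd : ∀ w ∈ U, DifferentiableAt ℂ J w := fun w hw =>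
    ((hasDerivAt_fst_comp (hψ.hasDerivAt_snd H.ne_zero (z := 1) hw)).differentiableAt.sub
      (hasDerivAt_fst_comp (hψ.hasDerivAt_snd H.ne_zero (z := 0) hw)).differentiableAt).mul
      (hmd'.differentiableAt (hUo.mem_nhds hw))
  have hR0 : ∀ w ∈ U, profile φ (m w).im * J w = profile φ w.im := by
    intro w hw
    have h1 := hψ.jacobian H.ne_zero 0 hw
    have h2 := hψ.fst_eq H.ne_zero H.bounded H.bounded_inv 1 hw
    rw [H.eq_of_im (hψ.mapsTo _ hw), H.eq_of_im (mk_mem_CxH (z := 0) hw)] at h1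
    rw [← show _ = profile φ w.im from h1, hJ]
    simp only [h2, mul_one, add_sub_cancel_right]
    rfl
  have hR1 : ∀ w ∈ U, logDer φ (m w).im * (starRingEnd ℂ) (deriv m w) = logDer φ w.im := by
    intro w hw
    have h1 := deriv_mul_conj_eq (H.hasDerivAt_profile (hmU w hw)) (H.hasDerivAt_profile hw)
      (hm1 w hw) (hJd w hw) (Filter.eventually_of_mem (hUo.mem_nhds hw) hR0)
    refine mul_right_cancel₀ (H.profile_ne_zero hw) ?_
    rw [← h1, ← hR0 w hw]
    ring
  have hw : ((y : ℂ) * Complex.I) ∈ U := by simpa [hU] using hy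
  have hmw : (m ((y : ℂ) * Complex.I)).im = Y := by simp [hm, hq]
  have hconj : ∀ t : ℝ, 0 < t → HasDerivAt (fun t => (starRingEnd ℂ) (logDer φ t))
      ((starRingEnd ℂ) (deriv (logDer φ) t)) t := fun t ht =>
    Complex.conjCLE.toContinuousLinearMap.hasFDerivAt.comp_hasDerivAt t
      (H.hasDerivAt_logDer ht).differentiableAt.hasDerivAt
  have h2 := deriv_mul_conj_eq (m := m) (K := deriv m) (w := (y : ℂ) * Complex.I)
    (hconj _ (hmU _ hw)) (hconj _ hw) (hm1 _ hw) (hmd'.differentiableAt (hUo.mem_nhds hw))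
    (Filter.eventually_of_mem (hUo.mem_nhds hw) fun s hs => by
      have := congrArg (starRingEnd ℂ) (hR1 s hs)
      simpa using this)
  rw [hmw] at h2
  refine ⟨Complex.normSq (deriv m ((y : ℂ) * Complex.I)), ?_⟩
  have h3 := congrArg (starRingEnd ℂ) h2
  simp only [map_mul, Complex.conj_conj] at h3
  rw [Complex.normSq_eq_conj_mul_self, mul_comm ((starRingEnd ℂ) _), ← mul_assoc, h3]
  simp

/-- The function `Im ℓ'` either vanishes identically or has no zero. If it vanishes, scaling
shows that `ℓ` is real, so that `φ` has constant argument, which is incompatible with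
`φ(cy) α c = φ(y)` as `α` is not real. -/
theorem im_deriv_logDer_ne_zero (H : HomogeneousForm X φ) {y : ℝ} (hy : 0 < y) :
    (deriv (logDer φ) y).im ≠ 0 := by
  intro hy0
  have hall : ∀ t : ℝ, 0 < t → (deriv (logDer φ) t).im = 0 := by
    intro t ht
    obtain ⟨r, hr⟩ := H.exists_logDer_deriv_eq ht hy
    rw [← hr, Complex.im_mul_ofReal, hy0, zero_mul]
  have hcd : ∀ t : ℝ, 0 < t → HasDerivAt (fun t => (logDer φ t).im) 0 t := by
    intro t ht
    have := Complex.imCLM.hasFDerivAt.comp_hasDerivAt t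
      (H.hasDerivAt_logDer ht).differentiableAt.hasDerivAt
    rw [Complex.imCLM_apply, hall t ht] at this
    exact this
  have hconst : ∀ t : ℝ, 0 < t → ∀ s : ℝ, 0 < s → (logDer φ t).im = (logDer φ s).im :=
    fun t ht s hs => isOpen_Ioi.is_const_of_deriv_eq_zero isPreconnected_Ioi
      (fun y hy => (hcd y hy).differentiableAt.differentiableWithinAt)
      (fun y hy => (hcd y hy).deriv) (Set.mem_Ioi.mpr ht) (Set.mem_Ioi.mpr hs)
  have him : ∀ t : ℝ, 0 < t → (logDer φ t).im = 0 := by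
    intro t ht
    have h1 := congrArg Complex.im (H.logDer_scaling ht)
    rw [Complex.im_mul_ofReal, hconst _ (mul_pos X.c_pos ht) t ht] at h1
    have h2 : (logDer φ t).im * (X.c - 1) = 0 := by linear_combination h1
    exact (mul_eq_zero.mp h2).resolve_right (sub_ne_zero.mpr X.one_lt_c.ne')
  have hrd : ∀ t : ℝ, 0 < t →
      HasDerivAt (fun t => (starRingEnd ℂ) (profile φ t) / profile φ t) 0 t := by
    intro t ht
    have h1 := H.hasDerivAt_profile ht
    have h2 : HasDerivAt (fun t => (starRingEnd ℂ) (profile φ t))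
        ((starRingEnd ℂ) (logDer φ t * profile φ t)) t :=
      Complex.conjCLE.toContinuousLinearMap.hasFDerivAt.comp_hasDerivAt t h1
    have h3 := h2.fun_div h1 (H.profile_ne_zero ht)
    rw [map_mul, Complex.conj_eq_iff_im.mpr (him t ht)] at h3
    have h4 : logDer φ t * (starRingEnd ℂ) (profile φ t) * profile φ t
        - (starRingEnd ℂ) (profile φ t) * (logDer φ t * profile φ t) = 0 := by ring
    rw [h4, zero_div] at h3
    exact h3
  have h1 : (1 : ℝ) ∈ Set.Ioi (0 : ℝ) := Set.mem_Ioi.mpr one_pos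
  have hc : X.c ∈ Set.Ioi (0 : ℝ) := X.c_pos
  have hratio := isOpen_Ioi.is_const_of_deriv_eq_zero isPreconnected_Ioi
      (fun y hy => (hrd y hy).differentiableAt.differentiableWithinAt)
      (fun y hy => (hrd y hy).deriv) hc h1
  have hs := H.profile_scaling (y := 1) one_pos
  rw [mul_one] at hs
  have hpc := H.profile_ne_zero X.c_pos
  rw [div_eq_div_iff hpc (H.profile_ne_zero one_pos), ← hs] at hratio
  simp only [map_mul, Complex.conj_ofReal] at hratio
  have hpc' : (starRingEnd ℂ) (profile φ X.c) ≠ 0 := (map_ne_zero _).mpr hpc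
  refine X.conj_α_ne (mul_left_cancel₀ (mul_ne_zero (mul_ne_zero hpc hpc') X.c_ne_zero) ?_)
  linear_combination -hratio

theorem im_fderiv_dlog_ne_zero (H : HomogeneousForm X φ) {p : ℂ × ℂ} (hp : p ∈ CxH) :
    (fderiv ℝ (dlog φ (0, Complex.I)) p (0, Complex.I)).im ≠ 0 := by
  have h1 := H.im_deriv_logDer_ne_zero (y := p.2.im) hp
  have hm : ∀ᶠ t : ℝ in nhds 0, p + t • ((0, Complex.I) : ℂ × ℂ) ∈ CxH :=
    (Continuous.tendsto' (by fun_prop) 0 p (by simp)).eventually (CxH_mem_nhds hp)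
  have h2 := hasDerivAt_line (f := dlog φ (0, Complex.I)) (p := p) (v := (0, Complex.I)) (t := 0)
    (differentiableAt_CxH (smooth_dlog H.smooth H.ne_zero _) (by simpa using hp))
  have h3 : HasDerivAt (fun t : ℝ => logDer φ (p.2.im + t)) (deriv (logDer φ) p.2.im) 0 := by
    have : HasDerivAt (logDer φ) (deriv (logDer φ) p.2.im) (p.2.im + 0) := by
      simpa using (H.hasDerivAt_logDer hp).differentiableAt.hasDerivAt
    exact this.comp_const_add p.2.im 0
  have h4 := h2.congr_of_eventuallyEq (f₁ := fun t : ℝ => logDer φ (p.2.im + t)) (by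
    filter_upwards [hm] with t ht
    rw [H.dlog_eq_of_im _ ht]
    simp [logDer])
  have h5 := h4.unique h3
  simp only [zero_smul, add_zero] at h5
  rwa [h5]

end HomogeneousForm

/-! ### Wirtinger derivatives -/

/-- Twice the Wirtinger derivative in the direction `v`: `∂/∂v̄` for `ε = i` and `∂/∂v` for
`ε = -i`. -/
noncomputable def wirtinger (ε : ℂ) (v : ℂ × ℂ) (f : ℂ × ℂ → ℂ) (p : ℂ × ℂ) : ℂ :=
  fderiv ℝ f p v + ε * fderiv ℝ f p (Complex.I • v)

section Wirtinger

variable {f g : ℂ × ℂ → ℂ} {p : ℂ × ℂ} (ε δ : ℂ) (u v : ℂ × ℂ)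

theorem wirtinger_congr (h : ∀ q ∈ CxH, f q = g q) (hp : p ∈ CxH) :
    wirtinger ε v f p = wirtinger ε v g p := by
  have : f =ᶠ[nhds p] g := Filter.eventually_of_mem (CxH_mem_nhds hp) h
  simp only [wirtinger, this.fderiv_eq]

theorem smooth_wirtinger (hf : ContDiffOn ℝ ∞ f CxH) :
    ContDiffOn ℝ ∞ (wirtinger ε v f) CxH :=
  (smooth_fderiv_apply hf v).add (contDiffOn_const.mul (smooth_fderiv_apply hf _))

theorem wirtinger_add (hf : ContDiffOn ℝ ∞ f CxH) (hg : ContDiffOn ℝ ∞ g CxH) (hp : p ∈ CxH) :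
    wirtinger ε v (fun q => f q + g q) p = wirtinger ε v f p + wirtinger ε v g p := by
  simp only [wirtinger]
  rw [fderiv_fun_add (differentiableAt_CxH hf hp) (differentiableAt_CxH hg hp)]
  simp only [add_apply]
  ring

theorem wirtinger_mul (hf : ContDiffOn ℝ ∞ f CxH) (hg : ContDiffOn ℝ ∞ g CxH) (hp : p ∈ CxH) :
    wirtinger ε v (fun q => f q * g q) p = wirtinger ε v f p * g p + f p * wirtinger ε v g p := by
  simp only [wirtinger]
  rw [fderiv_fun_mul (differentiableAt_CxH hf hp) (differentiableAt_CxH hg hp)]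
  simp only [add_apply, smul_apply, smul_eq_mul]
  ring

theorem wirtinger_const_mul (a : ℂ) (hf : ContDiffOn ℝ ∞ f CxH) (hp : p ∈ CxH) :
    wirtinger ε v (fun q => a * f q) p = a * wirtinger ε v f p := by
  simp only [wirtinger]
  rw [fderiv_const_mul (differentiableAt_CxH hf hp)]
  simp only [smul_apply, smul_eq_mul]
  ring

theorem fderiv_conj (hf : ContDiffOn ℝ ∞ f CxH) (hp : p ∈ CxH) :
    fderiv ℝ (fun q => (starRingEnd ℂ) (f q)) p v = (starRingEnd ℂ) (fderiv ℝ f p v) := by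
  have := (Complex.conjCLE.toContinuousLinearMap.hasFDerivAt.comp p
    (differentiableAt_CxH hf hp).hasFDerivAt).fderiv
  exact congrArg (fun L : ℂ × ℂ →L[ℝ] ℂ => L v) this

theorem smooth_conj (hf : ContDiffOn ℝ ∞ f CxH) :
    ContDiffOn ℝ ∞ (fun q => (starRingEnd ℂ) (f q)) CxH :=
  Complex.conjCLE.contDiff.comp_contDiffOn hf

theorem wirtinger_conj (hf : ContDiffOn ℝ ∞ f CxH) (hp : p ∈ CxH) :
    wirtinger ε v (fun q => (starRingEnd ℂ) (f q)) p
      = (starRingEnd ℂ) (wirtinger ((starRingEnd ℂ) ε) v f p) := by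
  simp only [wirtinger, fderiv_conj _ hf hp, map_add, map_mul, Complex.conj_conj]

theorem wirtinger_comm (hf : ContDiffOn ℝ ∞ f CxH) (hp : p ∈ CxH) :
    wirtinger ε u (wirtinger δ v f) p = wirtinger δ v (wirtinger ε u f) p := by
  have key : ∀ (δ : ℂ) (v w : ℂ × ℂ), fderiv ℝ (wirtinger δ v f) p w
      = fderiv ℝ (fun q => fderiv ℝ f q v) p w
        + δ * fderiv ℝ (fun q => fderiv ℝ f q (Complex.I • v)) p w := by
    intro δ v w
    have h1 := differentiableAt_CxH (smooth_fderiv_apply hf v) hp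
    have h2 := differentiableAt_CxH (smooth_fderiv_apply hf (Complex.I • v)) hp
    change fderiv ℝ (fun q => fderiv ℝ f q v + δ * fderiv ℝ f q (Complex.I • v)) p w = _
    rw [fderiv_fun_add h1 (h2.const_mul δ), fderiv_const_mul h2]
    simp
  rw [wirtinger, wirtinger, key, key, key, key, fderiv_fderiv_comm hf hp u v,
    fderiv_fderiv_comm hf hp u (Complex.I • v), fderiv_fderiv_comm hf hp (Complex.I • u) v,
    fderiv_fderiv_comm hf hp (Complex.I • u) (Complex.I • v)]
  ring

end Wirtinger

/-! ### The integrability equations have no solution -/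

namespace HomogeneousForm

variable {X : InoueDatum} {φ : ℂ × ℂ → ℂ}

/-- The logarithmic derivative of `φ` with respect to `Im w`. -/
local notation "ell" => dlog φ (0, Complex.I)

theorem I_smul_fst : Complex.I • ((1, 0) : ℂ × ℂ) = (Complex.I, 0) := by simp

theorem I_smul_snd : Complex.I • ((0, 1) : ℂ × ℂ) = (0, Complex.I) := by simp

theorem fderiv_eq_zero_of_dlog (H : HomogeneousForm X φ) {v p : ℂ × ℂ} (hp : p ∈ CxH)
    (h : dlog φ v p = 0) : fderiv ℝ φ p v = 0 :=
  (div_eq_zero_iff.mp h).resolve_right (H.ne_zero p hp)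

theorem wirtinger_fst (H : HomogeneousForm X φ) (ε : ℂ) {p : ℂ × ℂ} (hp : p ∈ CxH) :
    wirtinger ε (1, 0) φ p = 0 := by
  rw [wirtinger, I_smul_fst, H.fderiv_eq_zero_of_dlog hp (H.dlog_vertical_zero 1 hp),
    H.fderiv_eq_zero_of_dlog hp (H.dlog_vertical_zero Complex.I hp)]
  simp

theorem wirtinger_snd (H : HomogeneousForm X φ) (ε : ℂ) {p : ℂ × ℂ} (hp : p ∈ CxH) :
    wirtinger ε (0, 1) φ p = ε * ell p * φ p := by
  rw [wirtinger, I_smul_snd, H.fderiv_eq_zero_of_dlog hp (H.dlog_re hp), dlog, mul_assoc,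
    div_mul_cancel₀ _ (H.ne_zero p hp), zero_add]

theorem smooth_ell (H : HomogeneousForm X φ) : ContDiffOn ℝ ∞ ell CxH :=
  smooth_dlog H.smooth H.ne_zero _

theorem fderiv_ell (H : HomogeneousForm X φ) {v p : ℂ × ℂ} (hp : p ∈ CxH) (hv : v.2.im = 0) :
    fderiv ℝ ell p v = 0 := by
  have hm : ∀ t : ℝ, p + t • v ∈ CxH := fun t => by simpa [CxH, hv] using hp
  have h1 := hasDerivAt_line (f := ell) (p := p) (v := v) (t := 0)
    (differentiableAt_CxH H.smooth_ell (hm 0))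
  have h2 : (fun s : ℝ => ell (p + s • v)) = fun _ => ell p := by
    funext s
    rw [H.dlog_eq_of_im _ (hm s), H.dlog_eq_of_im _ hp]
    simp [hv]
  rw [h2] at h1
  simpa using h1.unique (hasDerivAt_const _ _)

theorem wirtinger_fst_ell (H : HomogeneousForm X φ) (ε : ℂ) {p : ℂ × ℂ} (hp : p ∈ CxH) :
    wirtinger ε (1, 0) ell p = 0 := by
  rw [wirtinger, I_smul_fst, H.fderiv_ell hp (by simp), H.fderiv_ell hp (by simp)]
  simp

theorem wirtinger_snd_ell (H : HomogeneousForm X φ) (ε : ℂ) {p : ℂ × ℂ} (hp : p ∈ CxH) :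
    wirtinger ε (0, 1) ell p = ε * fderiv ℝ ell p (0, Complex.I) := by
  rw [wirtinger, I_smul_snd, H.fderiv_ell hp (by simp), zero_add]

/-- The compatibility condition of the integrability equations
`∂̄₁ d = ∂̄₂ b - iℓ b` and `∂̄₁ b̄ = ∂̄₂ a - iℓ a` with `a` and `d` real: eliminating `b` gives
`Im ℓ' · a = 0`. -/
theorem eq_zero_of_integrability (H : HomogeneousForm X φ) {a b d : ℂ × ℂ → ℂ}
    (ha : ContDiffOn ℝ ∞ a CxH) (hb : ContDiffOn ℝ ∞ b CxH) (hd : ContDiffOn ℝ ∞ d CxH)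
    (ha_real : ∀ p ∈ CxH, (starRingEnd ℂ) (a p) = a p)
    (hd_real : ∀ p ∈ CxH, (starRingEnd ℂ) (d p) = d p)
    (h₁ : ∀ p ∈ CxH, wirtinger Complex.I (1, 0) d p
      = wirtinger Complex.I (0, 1) b p - Complex.I * ell p * b p)
    (h₂ : ∀ p ∈ CxH, wirtinger Complex.I (1, 0) (fun q => (starRingEnd ℂ) (b q)) p
      = wirtinger Complex.I (0, 1) a p - Complex.I * ell p * a p)
    {p : ℂ × ℂ} (hp : p ∈ CxH) : a p = 0 := by
  set β : ℂ × ℂ → ℂ := fun q => (starRingEnd ℂ) (b q) with hβ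
  have hβs : ContDiffOn ℝ ∞ β CxH := smooth_conj hb
  have hells := H.smooth_ell
  have hells' : ContDiffOn ℝ ∞ (fun q => (starRingEnd ℂ) (ell q)) CxH := smooth_conj hells
  have hreal : ∀ {f : ℂ × ℂ → ℂ}, ContDiffOn ℝ ∞ f CxH →
      (∀ p ∈ CxH, (starRingEnd ℂ) (f p) = f p) → ∀ (ε : ℂ) (v : ℂ × ℂ), ∀ p ∈ CxH,
      (starRingEnd ℂ) (wirtinger ε v f p) = wirtinger ((starRingEnd ℂ) ε) v f p := by
    intro f hf hfr ε v p hp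
    have := wirtinger_conj ((starRingEnd ℂ) ε) v hf hp
    rw [Complex.conj_conj] at this
    rw [← this]
    exact wirtinger_congr _ _ hfr hp
  -- the complex conjugate of the first equation
  have h₁' : ∀ p ∈ CxH, wirtinger (-Complex.I) (1, 0) d p
      = wirtinger (-Complex.I) (0, 1) β p + Complex.I * ((starRingEnd ℂ) (ell p) * β p) := by
    intro p hp
    have h := congrArg (starRingEnd ℂ) (h₁ p hp)
    rw [hreal hd hd_real _ _ p hp, map_sub, map_mul, map_mul, Complex.conj_I] at h
    rw [h, hβ, wirtinger_conj _ _ hb hp]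
    simp only [map_neg, Complex.conj_I, neg_neg]
    ring
  have hD : wirtinger (-Complex.I) (0, 1) (wirtinger Complex.I (1, 0) β) p
      = wirtinger (-Complex.I) (0, 1) (wirtinger Complex.I (0, 1) a) p
        - fderiv ℝ ell p (0, Complex.I) * a p
        - Complex.I * ell p * wirtinger (-Complex.I) (0, 1) a p := by
    rw [wirtinger_congr (g := fun q => wirtinger Complex.I (0, 1) a q
      + (-Complex.I) * (ell q * a q)) _ _ (fun q hq => by rw [h₂ q hq]; ring) hp,
      wirtinger_add _ _ (smooth_wirtinger _ _ ha) (contDiffOn_const.mul (hells.mul ha)) hp,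
      wirtinger_const_mul _ _ _ (hells.mul ha) hp, wirtinger_mul _ _ hells ha hp,
      H.wirtinger_snd_ell _ hp]
    linear_combination (fderiv ℝ ell p (0, Complex.I) * a p) * Complex.I_sq
  have hE : wirtinger Complex.I (1, 0) (wirtinger (-Complex.I) (1, 0) d) p
      = wirtinger Complex.I (1, 0) (wirtinger (-Complex.I) (0, 1) β) p
        + Complex.I * ((starRingEnd ℂ) (ell p) * wirtinger Complex.I (1, 0) β p) := by
    rw [wirtinger_congr _ _ h₁' hp,
      wirtinger_add _ _ (smooth_wirtinger _ _ hβs) (contDiffOn_const.mul (hells'.mul hβs)) hp,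
      wirtinger_const_mul _ _ _ (hells'.mul hβs) hp, wirtinger_mul _ _ hells' hβs hp,
      wirtinger_conj _ _ hells hp, H.wirtinger_fst_ell _ hp]
    simp
  rw [wirtinger_comm _ _ _ _ hβs hp, hD, h₂ p hp] at hE
  -- both sides are compared with their complex conjugates
  have hlap : ∀ {f : ℂ × ℂ → ℂ}, ContDiffOn ℝ ∞ f CxH →
      (∀ p ∈ CxH, (starRingEnd ℂ) (f p) = f p) → ∀ (ε : ℂ) (v : ℂ × ℂ),
      (starRingEnd ℂ) (wirtinger ((starRingEnd ℂ) ε) v (wirtinger ε v f) p)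
        = wirtinger ((starRingEnd ℂ) ε) v (wirtinger ε v f) p := by
    intro f hf hfr ε v
    have := wirtinger_conj ε v (smooth_wirtinger ε v hf) hp
    rw [← this, wirtinger_comm _ _ _ _ hf hp]
    exact wirtinger_congr _ _ (fun q hq => hreal hf hfr _ _ q hq) hp
  have hld := hlap hd hd_real (-Complex.I) (1, 0)
  have hla := hlap ha ha_real Complex.I (0, 1)
  have hra := hreal ha ha_real Complex.I (0, 1) p hp
  have hra' := hreal ha ha_real (-Complex.I) (0, 1) p hp
  simp only [map_neg, Complex.conj_I, neg_neg] at hld hla hra hra'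
  have hE' := congrArg (starRingEnd ℂ) hE
  simp only [map_add, map_sub, map_mul, hld, hla, hra, hra', Complex.conj_I, Complex.conj_conj,
    ha_real p hp] at hE'
  have hfin : ((starRingEnd ℂ) (fderiv ℝ ell p (0, Complex.I)) - fderiv ℝ ell p (0, Complex.I))
      * a p = 0 := by
    linear_combination hE' - hE
  refine (mul_eq_zero.mp hfin).resolve_left fun h => H.im_fderiv_dlog_ne_zero hp ?_
  exact Complex.conj_eq_iff_im.mp (sub_eq_zero.mp h)

end HomogeneousForm

namespace HomogeneousForm

variable {X : InoueDatum} {φ : ℂ × ℂ → ℂ}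

/-- A lattice-periodic function that is holomorphic in `z` is bounded on the fibres, hence
constant on them. -/
theorem _root_.InoueDatum.LatticePeriodic.const_fst {f : ℂ × ℂ → ℂ} (hf : X.LatticePeriodic f)
    (hs : ContDiffOn ℝ ∞ f CxH) (hd : ∀ p ∈ CxH, wirtinger Complex.I (1, 0) f p = 0)
    {p : ℂ × ℂ} (hp : p ∈ CxH) : f p = f (0, p.2) := by
  obtain ⟨C, hC⟩ := hf.bounded hs.continuousOn (y := p.2.im) hp
  refine Differentiable.apply_eq_apply_of_bounded (f := fun ζ : ℂ => f (ζ, p.2)) (fun ζ => ?_)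
    (isBounded_iff_forall_norm_le.mpr ⟨C, by rintro _ ⟨ζ, rfl⟩; exact hC _ rfl⟩) p.1 0
  have hm : ((ζ, p.2) : ℂ × ℂ) ∈ CxH := hp
  have h1 : HasFDerivAt (fun ζ : ℂ => f (ζ, p.2))
      ((fderiv ℝ f (ζ, p.2)).comp (ContinuousLinearMap.inl ℝ ℂ ℂ)) ζ :=
    (differentiableAt_CxH hs hm).hasFDerivAt.comp ζ (hasFDerivAt_prodMk_left ζ p.2)
  rw [differentiableAt_iff_restrictScalars ℝ h1.differentiableAt, h1.fderiv]
  refine ⟨ContinuousLinearMap.toSpanSingleton ℂ (fderiv ℝ f (ζ, p.2) (1, 0)), ?_⟩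
  have h2 := hd _ hm
  rw [wirtinger, I_smul_fst] at h2
  have h3 : fderiv ℝ f (ζ, p.2) (Complex.I, 0) = Complex.I * fderiv ℝ f (ζ, p.2) (1, 0) := by
    linear_combination (-Complex.I) * h2 + fderiv ℝ f (ζ, p.2) (Complex.I, 0) * Complex.I_sq
  ext v
  have hv : ((v, 0) : ℂ × ℂ) = v.re • ((1, 0) : ℂ × ℂ) + v.im • ((Complex.I, 0) : ℂ × ℂ) := by
    ext1
    · simp [Complex.re_add_im]
    · simp
  simp only [ContinuousLinearMap.coe_restrictScalars', ContinuousLinearMap.toSpanSingleton_apply,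
    ContinuousLinearMap.comp_apply, ContinuousLinearMap.inl_apply, smul_eq_mul]
  rw [hv, map_add, map_smul, map_smul, h3, Complex.real_smul, Complex.real_smul]
  conv_lhs => rw [← Complex.re_add_im v]
  ring

/-- The entries `sᵢⱼ` of the matrix of an antilinear structure `S` that is compatible with a
homogeneous form `φ dz ∧ dw` and satisfies the integrability equations do not exist. -/
theorem false_of_integrability (H : HomogeneousForm X φ) {s₁₁ s₁₂ s₂₁ s₂₂ : ℂ × ℂ → ℂ}
    (hs₁₁ : ContDiffOn ℝ ∞ s₁₁ CxH) (hs₁₂ : ContDiffOn ℝ ∞ s₁₂ CxH)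
    (hs₂₁ : ContDiffOn ℝ ∞ s₂₁ CxH) (hs₂₂ : ContDiffOn ℝ ∞ s₂₂ CxH)
    (hper₁₁ : X.LatticePeriodic s₁₁) (hper₁₂ : X.LatticePeriodic s₁₂)
    (hscale : ∀ p ∈ CxH, (starRingEnd ℂ) X.α * s₁₁ (X.α * p.1, X.c * p.2) = X.α * s₁₁ p)
    (hinv : ∀ p ∈ CxH, (starRingEnd ℂ) (s₁₁ p) * s₁₁ p + (starRingEnd ℂ) (s₂₁ p) * s₁₂ p = 1)
    (h₂₁ : ∀ p ∈ CxH, (starRingEnd ℂ) (φ p * s₂₁ p) = φ p * s₂₁ p)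
    (h₁₂ : ∀ p ∈ CxH, (starRingEnd ℂ) (φ p * s₁₂ p) = φ p * s₁₂ p)
    (h₂₂ : ∀ p ∈ CxH, φ p * s₂₂ p = -(starRingEnd ℂ) (φ p * s₁₁ p))
    (hint₁ : ∀ p ∈ CxH, wirtinger Complex.I (0, 1) s₁₁ p = wirtinger Complex.I (1, 0) s₁₂ p)
    (hint₂ : ∀ p ∈ CxH, wirtinger Complex.I (0, 1) s₂₁ p = wirtinger Complex.I (1, 0) s₂₂ p) :
    False := by
  have hφ := H.smooth
  have hE₁ : ∀ p ∈ CxH, wirtinger Complex.I (1, 0) (fun q => φ q * s₁₂ q) p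
      = φ p * wirtinger Complex.I (0, 1) s₁₁ p := by
    intro p hp
    rw [wirtinger_mul _ _ hφ hs₁₂ hp, H.wirtinger_fst _ hp, hint₁ p hp]
    ring
  have hE₂ : ∀ p ∈ CxH, wirtinger Complex.I (1, 0)
      (fun q => (starRingEnd ℂ) (φ q * s₁₁ q)) p
      = -(φ p * wirtinger Complex.I (0, 1) s₂₁ p) := by
    intro p hp
    rw [wirtinger_congr (g := fun q => (-1) * (φ q * s₂₂ q)) _ _
      (fun q hq => by rw [h₂₂ q hq]; ring) hp, wirtinger_const_mul _ _ _ (hφ.mul hs₂₂) hp,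
      wirtinger_mul _ _ hφ hs₂₂ hp, H.wirtinger_fst _ hp, hint₂ p hp]
    ring
  have hs₂₁0 : ∀ p ∈ CxH, s₂₁ p = 0 := by
    intro p hp
    have := H.eq_zero_of_integrability (a := fun q => (-1) * (φ q * s₂₁ q))
      (b := fun q => φ q * s₁₁ q) (d := fun q => φ q * s₁₂ q)
      (contDiffOn_const.mul (hφ.mul hs₂₁)) (hφ.mul hs₁₁) (hφ.mul hs₁₂)
      (fun q hq => by
        rw [map_mul (starRingEnd ℂ) (-1), h₂₁ q hq]
        simp) h₁₂ (fun q hq => by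
        rw [hE₁ q hq, wirtinger_mul _ _ hφ hs₁₁ hq, H.wirtinger_snd _ hq]
        ring) (fun q hq => by
        rw [hE₂ q hq, wirtinger_const_mul _ _ _ (hφ.mul hs₂₁) hq, wirtinger_mul _ _ hφ hs₂₁ hq,
          H.wirtinger_snd _ hq]
        ring) hp
    simpa [H.ne_zero p hp] using this
  -- `s₁₁` depends only on `Im w`
  have hs₁₁z : ∀ p ∈ CxH, s₁₁ p = s₁₁ (0, p.2) := by
    have hper : X.LatticePeriodic (fun q => (starRingEnd ℂ) (φ q * s₁₁ q)) := fun p hp i => by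
      simp only [H.periodic p hp i, hper₁₁ p hp i]
    intro p hp
    have h1 := hper.const_fst (smooth_conj (hφ.mul hs₁₁)) (fun q hq => by
      rw [hE₂ q hq, wirtinger_congr (g := fun _ => 0) _ _ hs₂₁0 hq]
      simp [wirtinger]) hp
    have h2 := (starRingEnd ℂ).injective h1
    have h3 : φ (0, p.2) = φ p := by
      rw [H.eq_of_im hp, H.eq_of_im (p := (0, p.2)) hp]
    rw [h3] at h2
    exact mul_left_cancel₀ (H.ne_zero p hp) h2
  have hs₁₁im : ∀ p ∈ CxH, s₁₁ p = s₁₁ (0, (p.2.im : ℂ) * Complex.I) := fun p hp =>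
    hper₁₁.eq_of_const_fst hs₁₁.continuousOn hs₁₁z hp
  -- `φ s₁₂` is real, bounded on the fibres, and has constant derivatives along them
  have hzero : ∀ p ∈ CxH, wirtinger Complex.I (0, 1) s₁₁ p = 0 := by
    intro p hp
    set d : ℂ × ℂ → ℂ := fun q => φ q * s₁₂ q with hd
    have hds : ContDiffOn ℝ ∞ d CxH := hφ.mul hs₁₂
    obtain ⟨C, hC⟩ := InoueDatum.LatticePeriodic.bounded (X := X) (f := d)
      (fun q hq i => by simp only [hd, H.periodic q hq i, hper₁₂ q hq i]) hds.continuousOn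
      (y := p.2.im) hp
    set κ := wirtinger Complex.I (1, 0) d p with hκ
    have hreal : ∀ q ∈ CxH, ∀ v, (starRingEnd ℂ) (fderiv ℝ d q v) = fderiv ℝ d q v := by
      intro q hq v
      rw [← fderiv_conj v hds hq]
      have : (fun q => (starRingEnd ℂ) (d q)) =ᶠ[nhds q] d :=
        Filter.eventually_of_mem (CxH_mem_nhds hq) h₁₂
      rw [this.fderiv_eq]
    have hinvar : ∀ u : ℂ, wirtinger Complex.I (1, 0) d (p + (u, 0)) = κ := by
      intro u
      have hpu : p + (u, 0) ∈ CxH := by simpa [CxH] using hp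
      rw [hκ, hE₁ p hp, hE₁ _ hpu, H.eq_of_im hpu, H.eq_of_im hp]
      simp only [wirtinger]
      rw [fderiv_add_of_invariant (a := (u, 0)) (fun q hq => by
        rw [hs₁₁z q hq, hs₁₁z (q + (u, 0)) (by simpa [CxH] using hq)]
        simp) hp]
      simp
    have hparts : ∀ u : ℂ, fderiv ℝ d (p + (u, 0)) (1, 0) = (κ + (starRingEnd ℂ) κ) / 2 ∧
        fderiv ℝ d (p + (u, 0)) (Complex.I, 0) = Complex.I * ((starRingEnd ℂ) κ - κ) / 2 := by
      intro u
      have hpu : p + (u, 0) ∈ CxH := by simpa [CxH] using hp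
      have h1 := hinvar u
      rw [wirtinger, I_smul_fst] at h1
      have h2 := congrArg (starRingEnd ℂ) h1
      rw [map_add, map_mul, hreal _ hpu, hreal _ hpu, Complex.conj_I] at h2
      constructor
      · linear_combination (h1 + h2) / 2
      · linear_combination Complex.I * (h2 - h1) / 2
          + (fderiv ℝ d (p + (u, 0)) (Complex.I, 0)) * Complex.I_sq
    have hline : ∀ v : ℂ, ∀ t : ℝ, p + t • ((v, 0) : ℂ × ℂ) ∈ CxH := fun v t => by
      simpa [CxH] using hp
    have hline' : ∀ (v : ℂ) (t : ℝ), p + t • ((v, 0) : ℂ × ℂ) = p + (t • v, 0) := fun v t => by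
      simp
    have hre : (κ + (starRingEnd ℂ) κ) / 2 = 0 :=
      eq_zero_of_bounded_of_fderiv_const (f := d) (p := p) (v := (1, 0)) (C := C)
        (fun t => differentiableAt_CxH hds (hline 1 t))
        (fun t => by rw [hline']; exact (hparts _).1)
        (fun t => hC _ (by simp))
    have him : Complex.I * ((starRingEnd ℂ) κ - κ) / 2 = 0 :=
      eq_zero_of_bounded_of_fderiv_const (f := d) (p := p) (v := (Complex.I, 0)) (C := C)
        (fun t => differentiableAt_CxH hds (hline Complex.I t))
        (fun t => by rw [hline']; exact (hparts _).2) (fun t => hC _ (by simp))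
    have hκ0 : κ = 0 := by
      linear_combination hre + Complex.I * him - ((starRingEnd ℂ) κ - κ) / 2 * Complex.I_sq
    rw [hκ, hE₁ p hp] at hκ0
    exact (mul_eq_zero.mp hκ0).resolve_left (H.ne_zero p hp)
  have hder : ∀ y : ℝ, 0 < y → HasDerivAt (fun t : ℝ => s₁₁ (0, (t : ℂ) * Complex.I)) 0 y := by
    intro y hy
    have hm := mul_I_mem hy
    have h1 := hasDerivAt_line (f := s₁₁) (p := 0) (v := (0, Complex.I)) (t := y)
      (differentiableAt_CxH hs₁₁ (by simpa using hm))
    simp only [zero_add, Prod.smul_mk, smul_zero, Complex.real_smul] at h1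
    have hmt : ∀ t : ℝ, ((0, (y : ℂ) * Complex.I) + t • ((0, 1) : ℂ × ℂ)) ∈ CxH := fun t => by
      simpa [CxH] using hy
    have h2 := hasDerivAt_line (f := s₁₁) (p := (0, (y : ℂ) * Complex.I)) (v := (0, 1)) (t := 0)
      (differentiableAt_CxH hs₁₁ (hmt 0))
    have h3 : (fun s : ℝ => s₁₁ ((0, (y : ℂ) * Complex.I) + s • ((0, 1) : ℂ × ℂ)))
        = fun _ => s₁₁ (0, (y : ℂ) * Complex.I) := by
      funext s
      rw [hs₁₁im _ (hmt s)]
      simp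
    rw [h3] at h2
    have h4 := h2.unique (hasDerivAt_const _ _)
    simp only [zero_smul, add_zero] at h4
    have h5 := hzero _ hm
    rw [wirtinger, I_smul_snd, h4, zero_add] at h5
    rwa [(mul_eq_zero.mp h5).resolve_left Complex.I_ne_zero] at h1
  have hconst := isOpen_Ioi.is_const_of_deriv_eq_zero isPreconnected_Ioi
    (fun y hy => (hder y hy).differentiableAt.differentiableWithinAt)
    (fun y hy => (hder y hy).deriv) (Set.mem_Ioi.mpr X.c_pos) (Set.mem_Ioi.mpr (one_pos (α := ℝ)))
  have hI : ((0, ((1 : ℝ) : ℂ) * Complex.I) : ℂ × ℂ) ∈ CxH := mul_I_mem one_pos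
  have h1 := hscale _ hI
  simp only [mul_zero] at h1
  rw [Complex.ofReal_one, one_mul] at h1 hconst hI
  rw [hconst] at h1
  have h2 : s₁₁ (0, Complex.I) = 0 := by
    have : ((starRingEnd ℂ) X.α - X.α) * s₁₁ (0, Complex.I) = 0 := by linear_combination h1
    exact (mul_eq_zero.mp this).resolve_left (sub_ne_zero.mpr X.conj_α_ne)
  have h3 := hinv _ hI
  rw [h2, hs₂₁0 _ hI] at h3
  simp at h3

end HomogeneousForm

/-! ### Para-hyperhermitian structures in coordinates -/

namespace InoueDatum.ParaHyperhermitianStructure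

variable {X : InoueDatum} (P : X.ParaHyperhermitianStructure)

theorem S_I_smul {p : ℂ × ℂ} (hp : p ∈ CxH) (u : ℂ × ℂ) :
    P.S p (Complex.I • u) = -(Complex.I • P.S p u) := by
  have h := P.I_S_anticomm p hp u
  rw [P.I_eq_complex_structure p hp, P.I_eq_complex_structure p hp] at h
  rw [h, neg_neg]

theorem S_smul {p : ℂ × ℂ} (hp : p ∈ CxH) (c : ℂ) (u : ℂ × ℂ) :
    P.S p (c • u) = (starRingEnd ℂ) c • P.S p u := by
  have h1 : c • u = c.re • u + c.im • (Complex.I • u) := by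
    conv_lhs => rw [← Complex.re_add_im c]
    rw [add_smul, mul_smul, Complex.coe_smul, Complex.coe_smul]
  have h2 : (starRingEnd ℂ) c = (c.re : ℂ) + (c.im : ℂ) * -Complex.I := by
    apply Complex.ext <;> simp
  rw [h1, map_add, map_smul, map_smul, P.S_I_smul hp, h2, add_smul, mul_smul, Complex.coe_smul,
    Complex.coe_smul, neg_smul]

theorem T_apply {p : ℂ × ℂ} (hp : p ∈ CxH) (u : ℂ × ℂ) :
    P.T p u = Complex.I • P.S p u := by
  rw [P.T_eq p hp, P.I_eq_complex_structure p hp]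

theorem form20_add_left (p u u' v : ℂ × ℂ) :
    P.form20 p (u + u') v = P.form20 p u v + P.form20 p u' v := by
  simp only [ParaHyperhermitian.form20, map_add, add_apply, Complex.ofReal_add]
  ring

theorem form20_real_smul_left (p u v : ℂ × ℂ) (r : ℝ) :
    P.form20 p (r • u) v = r * P.form20 p u v := by
  simp only [ParaHyperhermitian.form20, map_smul, smul_apply, smul_eq_mul, Complex.ofReal_mul]
  ring

/-- `Ω` has type `(2,0)`. -/
theorem form20_I_smul_left {p : ℂ × ℂ} (hp : p ∈ CxH) (u v : ℂ × ℂ) :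
    P.form20 p (Complex.I • u) v = Complex.I * P.form20 p u v := by
  simp only [ParaHyperhermitian.form20, P.T_apply hp, P.S_I_smul hp, smul_neg, smul_smul,
    Complex.I_mul_I, neg_smul, one_smul, neg_neg, map_neg, neg_apply, Complex.ofReal_neg]
  linear_combination -(P.g p (Complex.I • P.S p u) v : ℂ) * Complex.I_sq

theorem form20_smul_left {p : ℂ × ℂ} (hp : p ∈ CxH) (c : ℂ) (u v : ℂ × ℂ) :
    P.form20 p (c • u) v = c * P.form20 p u v := by
  have h1 : c • u = c.re • u + c.im • (Complex.I • u) := by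
    conv_lhs => rw [← Complex.re_add_im c]
    rw [add_smul, mul_smul, Complex.coe_smul, Complex.coe_smul]
  rw [h1, form20_add_left, form20_real_smul_left, form20_real_smul_left, P.form20_I_smul_left hp]
  conv_rhs => rw [← Complex.re_add_im c]
  ring

theorem form20_swap {p : ℂ × ℂ} (hp : p ∈ CxH) (u v : ℂ × ℂ) :
    P.form20 p u v = -P.form20 p v u := by
  simp only [ParaHyperhermitian.form20]
  rw [P.S_skew p hp u v, P.T_skew p hp u v, P.g_symm p hp u, P.g_symm p hp u]
  push_cast
  ring

/-- The coefficient `φ` of `Ω = φ dz ∧ dw`. -/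
noncomputable def coeff (p : ℂ × ℂ) : ℂ := P.form20 p (1, 0) (0, 1)

theorem form20_eq {p : ℂ × ℂ} (hp : p ∈ CxH) (u v : ℂ × ℂ) :
    P.form20 p u v = P.coeff p * wedge u v := by
  have hd : ∀ u : ℂ × ℂ, u = u.1 • ((1, 0) : ℂ × ℂ) + u.2 • ((0, 1) : ℂ × ℂ) := fun u => by
    ext1 <;> simp
  have hself : ∀ u, P.form20 p u u = 0 := fun u => by
    have := P.form20_swap hp u u
    exact self_eq_neg.mp this
  have hleft : ∀ u v, P.form20 p u v
      = u.1 * P.form20 p (1, 0) v + u.2 * P.form20 p (0, 1) v := fun u v => by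
    conv_lhs => rw [hd u]
    rw [form20_add_left, P.form20_smul_left hp, P.form20_smul_left hp]
  rw [hleft, P.form20_swap hp (1, 0) v, P.form20_swap hp (0, 1) v, hleft v, hleft v, hself, hself,
    P.form20_swap hp (0, 1) (1, 0), wedge, coeff]
  ring

theorem coeff_ne_zero (p : ℂ × ℂ) (hp : p ∈ CxH) : P.coeff p ≠ 0 := by
  intro h
  have h1 : ∀ v, P.g p (P.S p (1, 0)) v = 0 := fun v => by
    have := congrArg Complex.re (P.form20_eq hp (1, 0) v)
    simpa [ParaHyperhermitian.form20, h] using this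
  have h2 := P.S_sq p hp (1, 0)
  rw [P.g_nondegenerate p hp _ h1, map_zero] at h2
  exact one_ne_zero (congrArg Prod.fst h2).symm

theorem smooth_coeff : ContDiffOn ℝ ∞ P.coeff CxH := by
  have key : ∀ {A : ℂ × ℂ → ℂ × ℂ →L[ℝ] ℂ × ℂ}, ContDiffOn ℝ ∞ A CxH →
      ContDiffOn ℝ ∞ (fun p => ((P.g p (A p (1, 0)) (0, 1) : ℝ) : ℂ)) CxH := fun hA =>
    Complex.ofRealCLM.contDiff.comp_contDiffOn
      ((P.smooth_g.clm_apply (hA.clm_apply contDiffOn_const)).clm_apply contDiffOn_const)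
  exact (key P.smooth_S).add (contDiffOn_const.mul (key P.smooth_T))

theorem form20_map {γ : Equiv.Perm (ℂ × ℂ)} (hγ : γ ∈ X.Γ) {p : ℂ × ℂ} (hp : p ∈ CxH)
    (u v : ℂ × ℂ) :
    P.form20 (γ p) (fderiv ℝ γ p u) (fderiv ℝ γ p v) = P.form20 p u v := by
  have h := P.invariant γ hγ
  simp only [ParaHyperhermitian.form20]
  rw [h.S_eq p hp, h.T_eq p hp, h.g_eq p hp, h.g_eq p hp]

theorem gen_mem (i : Fin 3) : X.gen i ∈ X.Γ :=
  Subgroup.subset_closure (Set.mem_insert_of_mem _ (Set.mem_range_self i))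

theorem gen0_mem : X.gen0 ∈ X.Γ := Subgroup.subset_closure (Set.mem_insert _ _)

theorem fderiv_gen (i : Fin 3) (p u : ℂ × ℂ) : fderiv ℝ (X.gen i) p u = u := by
  have : (X.gen i : ℂ × ℂ → ℂ × ℂ) = fun q => q + (X.αvec i, (X.cvec i : ℂ)) := rfl
  rw [this, fderiv_add_const]
  simp

theorem fderiv_gen0 (p u : ℂ × ℂ) : fderiv ℝ X.gen0 p u = (X.α * u.1, (X.c : ℂ) * u.2) := by
  have h1 : HasFDerivAt X.gen0
      ((X.α • ContinuousLinearMap.fst ℝ ℂ ℂ).prod ((X.c : ℂ) • ContinuousLinearMap.snd ℝ ℂ ℂ)) p :=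
    (hasFDerivAt_fst.const_mul X.α).prodMk (hasFDerivAt_snd.const_mul (X.c : ℂ))
  rw [h1.fderiv]
  simp

theorem gen_apply (i : Fin 3) (p : ℂ × ℂ) : X.gen i p = p + (X.αvec i, (X.cvec i : ℂ)) := rfl

theorem gen0_apply (p : ℂ × ℂ) : X.gen0 p = (X.α * p.1, (X.c : ℂ) * p.2) := rfl

theorem coeff_periodic : X.LatticePeriodic P.coeff := fun p hp i => by
  have := P.form20_map (gen_mem i) hp (1, 0) (0, 1)
  rwa [fderiv_gen, fderiv_gen, gen_apply] at this

theorem S_periodic (v : ℂ × ℂ) : X.LatticePeriodic (fun p => P.S p v) := fun p hp i => by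
  have := (P.invariant _ (gen_mem i)).S_eq p hp v
  rwa [fderiv_gen, fderiv_gen, gen_apply] at this

theorem coeff_scaling {p : ℂ × ℂ} (hp : p ∈ CxH) :
    P.coeff (X.α * p.1, X.c * p.2) * (X.α * X.c) = P.coeff p := by
  have := P.form20_map gen0_mem hp (1, 0) (0, 1)
  rw [fderiv_gen0, fderiv_gen0, gen0_apply,
    P.form20_eq (HomogeneousForm.scale_mem (X := X) hp)] at this
  simpa [wedge, coeff] using this

theorem S_scaling {p : ℂ × ℂ} (hp : p ∈ CxH) :
    (starRingEnd ℂ) X.α * (P.S (X.α * p.1, X.c * p.2) (1, 0)).1 = X.α * (P.S p (1, 0)).1 := by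
  have h := (P.invariant _ gen0_mem).S_eq p hp (1, 0)
  rw [fderiv_gen0, fderiv_gen0, gen0_apply] at h
  have h1 : ((X.α * ((1, 0) : ℂ × ℂ).1, (X.c : ℂ) * ((1, 0) : ℂ × ℂ).2) : ℂ × ℂ)
      = X.α • ((1, 0) : ℂ × ℂ) := by simp
  rw [h1, P.S_smul (HomogeneousForm.scale_mem (X := X) hp)] at h
  exact congrArg Prod.fst h

/-- The form `Ω(S·,·)` is the Hermitian form `g + i g(I·,·)`. -/
theorem form20_S_left {p : ℂ × ℂ} (hp : p ∈ CxH) (u v : ℂ × ℂ) :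
    P.form20 p (P.S p u) v = P.g p u v + Complex.I * P.g p (Complex.I • u) v := by
  simp only [ParaHyperhermitian.form20, P.T_apply hp, P.S_sq p hp]

theorem form20_S_conj {p : ℂ × ℂ} (hp : p ∈ CxH) (u v : ℂ × ℂ) :
    (starRingEnd ℂ) (P.form20 p (P.S p u) v) = P.form20 p (P.S p v) u := by
  have h := P.I_skew p hp u v
  rw [P.I_eq_complex_structure p hp, P.I_eq_complex_structure p hp,
    P.g_symm p hp u (Complex.I • v)] at h
  rw [P.form20_S_left hp, P.form20_S_left hp, h, P.g_symm p hp u v]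
  simp

theorem S_col_smooth (v : ℂ × ℂ) : ContDiffOn ℝ ∞ (fun p => P.S p v) CxH :=
  P.smooth_S.clm_apply contDiffOn_const

theorem nijenhuis_const {p : ℂ × ℂ} (u v : ℂ × ℂ) :
    nijenhuis P.S (fun _ => u) (fun _ => v) p
      = fderiv ℝ (fun q => P.S q v) p (P.S p u) - fderiv ℝ (fun q => P.S q u) p (P.S p v)
        + P.S p (fderiv ℝ (fun q => P.S q u) p v) - P.S p (fderiv ℝ (fun q => P.S q v) p u) := by
  simp only [nijenhuis, VectorField.lieBracket, fderiv_const_apply, zero_apply,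
    sub_zero, map_zero, zero_sub, map_neg, sub_neg_eq_add, add_zero]

theorem fderiv_S_I {p : ℂ × ℂ} (hp : p ∈ CxH) (u v : ℂ × ℂ) :
    fderiv ℝ (fun q => P.S q (Complex.I • u)) p v
      = -(Complex.I • fderiv ℝ (fun q => P.S q u) p v) := by
  have h1 : (fun q => P.S q (Complex.I • u)) =ᶠ[nhds p] fun q => (-Complex.I) • P.S q u :=
    Filter.eventually_of_mem (CxH_mem_nhds hp) fun q hq => by
      simp only [P.S_I_smul hq, neg_smul]
  rw [h1.fderiv_eq, fderiv_fun_const_smul (differentiableAt_CxH (P.S_col_smooth u) hp),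
    smul_apply, neg_smul]

/-- Since `S` is antilinear, the part of its Nijenhuis tensor that is complex bilinear is
`S (∂̄₂ S e₁ - ∂̄₁ S e₂)`. -/
theorem S_integrability {p : ℂ × ℂ} (hp : p ∈ CxH) (u v : ℂ × ℂ) :
    fderiv ℝ (fun q => P.S q u) p v + Complex.I • fderiv ℝ (fun q => P.S q u) p (Complex.I • v)
      = fderiv ℝ (fun q => P.S q v) p u
        + Complex.I • fderiv ℝ (fun q => P.S q v) p (Complex.I • u) := by
  have hN : ∀ u v : ℂ × ℂ, nijenhuis P.S (fun _ => u) (fun _ => v) p = 0 := fun u v =>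
    P.S_integrable _ _ contDiffOn_const contDiffOn_const p hp
  have h1 := hN u v
  have h2 := hN (Complex.I • u) v
  have h3 := hN u (Complex.I • v)
  have h4 := hN (Complex.I • u) (Complex.I • v)
  rw [nijenhuis_const] at h1 h2 h3 h4
  simp only [P.fderiv_S_I hp, P.S_I_smul hp, map_neg, smul_neg, neg_neg] at h1 h2 h3 h4
  have hS : ∀ x : ℂ × ℂ, P.S p (P.S p x) = x := P.S_sq p hp
  have hz : P.S p (fderiv ℝ (fun q => P.S q u) p v
      + Complex.I • fderiv ℝ (fun q => P.S q u) p (Complex.I • v)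
      - (fderiv ℝ (fun q => P.S q v) p u
        + Complex.I • fderiv ℝ (fun q => P.S q v) p (Complex.I • u))) = 0 := by
    simp only [map_add, map_sub, P.S_I_smul hp]
    have key : ∀ {a b c d a' b' c' d' : ℂ}, a - b + c - d = 0 →
        -a' - -(Complex.I * b) + Complex.I * c - d' = 0 →
        -(Complex.I * a) - -b' + c' - Complex.I * d = 0 →
        Complex.I * a' - Complex.I * b' + Complex.I * c' - Complex.I * d' = 0 →
        c + -(Complex.I * c') - (d + -(Complex.I * d')) = 0 := by
      intro a b c d a' b' c' d' e1 e2 e3 e4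
      linear_combination (e1 - Complex.I * e2 - Complex.I * e3 - e4) / 2
        + (c - d + b - a) / 2 * Complex.I_sq
    exact Prod.ext
      (key (congrArg Prod.fst h1) (congrArg Prod.fst h2) (congrArg Prod.fst h3)
        (congrArg Prod.fst h4))
      (key (congrArg Prod.snd h1) (congrArg Prod.snd h2) (congrArg Prod.snd h3)
        (congrArg Prod.snd h4))
  have := congrArg (P.S p) hz
  rw [hS, map_zero] at this
  exact sub_eq_zero.mp this

end InoueDatum.ParaHyperhermitianStructure

namespace InoueDatum.ParaHyperhermitianStructure

variable {X : InoueDatum} (P : X.ParaHyperhermitianStructure)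

/-- A para-hyperhermitian structure with homogeneous `(2,0)`-form does not exist. -/
theorem not_homogeneousForm : ¬ HomogeneousForm X P.coeff := by
  intro H
  have hentry : ∀ v, ContDiffOn ℝ ∞ (fun p => (P.S p v).1) CxH ∧
      ContDiffOn ℝ ∞ (fun p => (P.S p v).2) CxH := fun v =>
    ⟨contDiff_fst.comp_contDiffOn (P.S_col_smooth v),
      contDiff_snd.comp_contDiffOn (P.S_col_smooth v)⟩
  have hfst : ∀ {p : ℂ × ℂ}, p ∈ CxH → ∀ u v,
      fderiv ℝ (fun q => (P.S q u).1) p v = (fderiv ℝ (fun q => P.S q u) p v).1 :=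
    fun hp u v => congrArg (fun L : ℂ × ℂ →L[ℝ] ℂ => L v)
      ((ContinuousLinearMap.fst ℝ ℂ ℂ).hasFDerivAt.comp _
        (differentiableAt_CxH (P.S_col_smooth u) hp).hasFDerivAt).fderiv
  have hsnd : ∀ {p : ℂ × ℂ}, p ∈ CxH → ∀ u v,
      fderiv ℝ (fun q => (P.S q u).2) p v = (fderiv ℝ (fun q => P.S q u) p v).2 :=
    fun hp u v => congrArg (fun L : ℂ × ℂ →L[ℝ] ℂ => L v)
      ((ContinuousLinearMap.snd ℝ ℂ ℂ).hasFDerivAt.comp _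
        (differentiableAt_CxH (P.S_col_smooth u) hp).hasFDerivAt).fderiv
  have hH : ∀ {p : ℂ × ℂ}, p ∈ CxH → ∀ u v, (starRingEnd ℂ) (P.coeff p * wedge (P.S p u) v)
      = P.coeff p * wedge (P.S p v) u := fun hp u v => by
    rw [← P.form20_eq hp, ← P.form20_eq hp, P.form20_S_conj hp]
  refine H.false_of_integrability (s₁₁ := fun p => (P.S p (1, 0)).1)
    (s₁₂ := fun p => (P.S p (0, 1)).1) (s₂₁ := fun p => (P.S p (1, 0)).2)
    (s₂₂ := fun p => (P.S p (0, 1)).2) (hentry _).1 (hentry _).1 (hentry _).2 (hentry _).2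
    (fun p hp i => congrArg Prod.fst (P.S_periodic (1, 0) p hp i))
    (fun p hp i => congrArg Prod.fst (P.S_periodic (0, 1) p hp i))
    (fun p hp => P.S_scaling hp) ?_ ?_ ?_ ?_ ?_ ?_
  · intro p hp
    have hcol : P.S p (1, 0) = (P.S p (1, 0)).1 • ((1, 0) : ℂ × ℂ)
        + (P.S p (1, 0)).2 • ((0, 1) : ℂ × ℂ) := by
      ext1 <;> simp
    have h := P.S_sq p hp (1, 0)
    rw [hcol, map_add, P.S_smul hp, P.S_smul hp] at h
    exact congrArg Prod.fst h
  · intro p hp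
    have h := hH hp (1, 0) (1, 0)
    simp only [wedge, mul_zero, mul_one, zero_sub, mul_neg, map_neg, neg_inj] at h
    exact h
  · intro p hp
    have h := hH hp (0, 1) (0, 1)
    simp only [wedge, mul_zero, mul_one, sub_zero] at h
    exact h
  · intro p hp
    have h := hH hp (1, 0) (0, 1)
    simp only [wedge, mul_zero, mul_one, sub_zero, zero_sub, mul_neg] at h
    rw [h, neg_neg]
  · intro p hp
    have h := congrArg Prod.fst (P.S_integrability hp (1, 0) (0, 1))
    simp only [wirtinger, hfst hp]
    exact h
  · intro p hp
    have h := congrArg Prod.snd (P.S_integrability hp (1, 0) (0, 1))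
    simp only [wirtinger, hsnd hp]
    exact h

end InoueDatum.ParaHyperhermitianStructure

/-! ### Left translations -/

section LeftTranslation

variable {X : InoueDatum} {E : Type*} [NormedAddCommGroup E] [NormedSpace ℝ E]
  {G : Type*} [TopologicalSpace G] [ChartedSpace E G] [Group G]

/-- The left translation by `a`, transported to `ℂ × H`. -/
def InoueDatum.QuotientPresentation.translation (Q : X.QuotientPresentation E G) (a : G)
    (p : ℂ × ℂ) : ℂ × ℂ := Q.Ψ (a * Q.Φ p)

variable [LieGroup 𝓘(ℝ, E) ∞ G]

theorem InoueDatum.QuotientPresentation.preservesForm (Q : X.QuotientPresentation E G)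
    {P : X.ParaHyperhermitianStructure}
    {η : (x : G) → TangentSpace 𝓘(ℝ, E) x [⋀^Fin 2]→L[ℝ] ℂ}
    (hη : IsLeftInvariantTwoForm η) (hP : P.Form20DefinedBy Q η) (a : G) :
    PreservesForm P.coeff (Q.translation a) := by
  have hΦ : ∀ p ∈ CxH, ContMDiffAt 𝓘(ℝ, ℂ × ℂ) 𝓘(ℝ, E) ∞ Q.Φ p := fun p hp =>
    Q.smooth_Φ.contMDiffAt (CxH_mem_nhds hp)
  have hL : ContMDiff 𝓘(ℝ, E) 𝓘(ℝ, E) ∞ (fun y : G => a * y) := contMDiff_mul_left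
  have hψ : ∀ p ∈ CxH, ContMDiffAt 𝓘(ℝ, ℂ × ℂ) 𝓘(ℝ, ℂ × ℂ) ∞ (Q.translation a) p := fun p hp =>
    (Q.smooth_Ψ.contMDiffAt.comp p (hL.contMDiffAt.comp p (hΦ p hp)))
  have hmaps : ∀ p ∈ CxH, Q.translation a p ∈ CxH := fun p _ => Q.Ψ_mem _
  refine ⟨hmaps, fun p hp => (contMDiffAt_iff_contDiffAt.mp (hψ p hp)).contDiffWithinAt,
    fun p hp u v => ?_⟩
  rw [← P.form20_eq (hmaps p hp), ← P.form20_eq hp, hP p hp, hP _ (hmaps p hp)]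
  have hval : Q.Φ (Q.translation a p) = a * Q.Φ p := Q.Φ_Ψ _
  have hd : ∀ w : ℂ × ℂ, mfderiv 𝓘(ℝ, ℂ × ℂ) 𝓘(ℝ, E) Q.Φ (Q.translation a p)
      (fderiv ℝ (Q.translation a) p w)
      = mfderiv 𝓘(ℝ, E) 𝓘(ℝ, E) (fun y => a * y) (Q.Φ p)
        (mfderiv 𝓘(ℝ, ℂ × ℂ) 𝓘(ℝ, E) Q.Φ p w) := by
    intro w
    have h1 : mfderiv 𝓘(ℝ, ℂ × ℂ) 𝓘(ℝ, E) (Q.Φ ∘ Q.translation a) p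
        = mfderiv 𝓘(ℝ, ℂ × ℂ) 𝓘(ℝ, E) ((fun y => a * y) ∘ Q.Φ) p := by
      have : Q.Φ ∘ Q.translation a = (fun y => a * y) ∘ Q.Φ := funext fun q => Q.Φ_Ψ _
      rw [this]
    rw [mfderiv_comp p ((hΦ _ (hmaps p hp)).mdifferentiableAt (by simp))
      ((hψ p hp).mdifferentiableAt (by simp)),
      mfderiv_comp p (hL.contMDiffAt.mdifferentiableAt (by simp))
      ((hΦ p hp).mdifferentiableAt (by simp)), mfderiv_eq_fderiv] at h1
    exact congrArg (fun L : ℂ × ℂ →L[ℝ] E => L w) h1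
  have h2 := hη a (Q.Φ p) (mfderiv 𝓘(ℝ, ℂ × ℂ) 𝓘(ℝ, E) Q.Φ p u)
    (mfderiv 𝓘(ℝ, ℂ × ℂ) 𝓘(ℝ, E) Q.Φ p v)
  rw [← h2, hd, hd]
  exact congrArg (fun x : G => (η x : (Fin 2 → E) → ℂ) _) hval

theorem InoueDatum.QuotientPresentation.homogeneousForm (Q : X.QuotientPresentation E G)
    {P : X.ParaHyperhermitianStructure}
    {η : (x : G) → TangentSpace 𝓘(ℝ, E) x [⋀^Fin 2]→L[ℝ] ℂ}
    (hη : IsLeftInvariantTwoForm η) (hP : P.Form20DefinedBy Q η) :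
    HomogeneousForm X P.coeff where
  smooth := P.smooth_coeff
  ne_zero := P.coeff_ne_zero
  periodic := P.coeff_periodic
  scaling _ hp := P.coeff_scaling hp
  transitive p hp q hq := by
    refine ⟨Q.translation (Q.Φ q * (Q.Φ p)⁻¹), Q.preservesForm hη hP _, ?_, ?_⟩
    · simp [InoueDatum.QuotientPresentation.translation, Q.Ψ_Φ q hq]
    · rintro ⟨r, -, hr⟩ s hs
      have h1 := congrArg Q.Φ hr
      rw [InoueDatum.QuotientPresentation.translation, Q.Φ_Ψ, mul_eq_right] at h1
      rw [h1, InoueDatum.QuotientPresentation.translation, one_mul, Q.Ψ_Φ s hs]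

end LeftTranslation

theorem theorem12 (X : InoueDatum)
    {E : Type*} [NormedAddCommGroup E] [NormedSpace ℝ E]
    {G : Type*} [TopologicalSpace G] [ChartedSpace E G] [Group G]
    [LieGroup 𝓘(ℝ, E) ∞ G] [Group.IsSolvable G]
    (Q : X.QuotientPresentation E G) :
    ¬ ∃ (P : X.ParaHyperhermitianStructure)
        (η : (x : G) → TangentSpace 𝓘(ℝ, E) x [⋀^Fin 2]→L[ℝ] ℂ),
      IsLeftInvariantTwoForm η ∧ P.Form20DefinedBy Q η := by
  rintro ⟨P, η, hη, hP⟩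
  exact P.not_homogeneousForm (Q.homogeneousForm hη hP)
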